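/- All digraphs are finite and loopless but may have parallel arcs. A rooted digraph $D=(V+r,A)$ is a digraph with vertex set $V\cup\{r\}$, $r\notin V$, in which no arc enters the root $r$; subdigraphs of $D$ are of the form $(V'+r,A')$ with $V'\subseteq V$ and $A'\subseteq A$. For $j\ge 1$, $D$ is $j$-root-connected if at least $j$ arcs enter every nonempty $S\subseteq V$; root-connected means $1$-root-connected. Let $k\ge 1$ be an integer. A rooted digraph $X=(V+r,A)$ with $n=|V|+1$ vertices is an $(r,k)$-flow branching if there is a function $z:A\to\mathbb{Z}_{\ge 0}$ with $z(a)\le n-k$ for all $a\in A$, $z(\delta^+(r))-z(\delta^-(r))=n-1$, and $z(\delta^-(v))-z(\delta^+(v))=1$ for all $v\in V$. It is triple-free if it has at most two arcs in the same direction between any two vertices. A spanning $(r,k)$-flow branching of $D$ is a subdigraph of $D$ with the same vertex set as $D$ that is an $(r,k)$-flow branching. Let $D=(V+r,A)$ be a rooted digraph. A vertex is large if it has at least $20k^2+1$ out-neighbours in $D$; let $L_D$ be the set of large vertices. A compact $(r,k)$-core of $D$ is a subdigraph $X=(V'+r,A')$ of $D$ with $|V'|\le 2k-1$ such that all vertices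 in $V'\cap L_D$ are sinks of $X$, and such that an $(r,k)$-flow branching $Y$ (not necessarily a subdigraph of $D$) can be obtained from $X$ by adding a set $V^*$ of $2k-1-|V'|$ new vertices and, for each $v\in V^*$, one arc to $v$ from a vertex in $V'\cap L_D$. A pair $\big((V_1+r,A_1),(V_2+r,A_2)\big)$ of subdigraphs of $D$ is extendable if $D-A_1$ and $D-A_2$ are both root-connected. **Lemma.** Let $D=(V+r,A)$ be a $2$-root-connected rooted digraph with $|V|\ge 2k-1$. Then $D$ has two arc-disjoint spanning $(r,k)$-flow branchings if and only if $D$ contains an extendable pair of arc-disjoint compact $(r,k)$-cores. Further, there is an algorithm that, given such $D$ and $k$ and an extendable pair of triple-free arc-disjoint compact $(r,k)$-cores of $D$, finds a pair of arc-disjoint spanning $(r,k)$-flow branchings of $D$ in time polynomial in $|V|+|A|$ (with a polynomial that does not depend on $k$). -/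

import Mathlib

/-- A rooted digraph `D = (V + r, A)`: a loopless digraph, possibly with parallel arcs, on the
vertex set `V + r`, in which no arc enters the root `r`. The vertex set `V + r` is `Option V`, the
root being `none`; the head of an arc always lies in `V`. -/
structure RootedDigraph (V A : Type*) where
  tail : A → Option V
  head : A → V
  loopless : ∀ a, tail a ≠ some (head a)

namespace RootedDigraph

section Basic

variable {V A : Type*} [Fintype V] [Fintype A] [DecidableEq V] [DecidableEq A]
  (D : RootedDigraph V A)

/-- The set `δ⁻(S)` of arcs entering `S ⊆ V`. -/
def entering (S : Finset V) : Finset A :=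
  Finset.univ.filter fun a => D.head a ∈ S ∧ ∀ v ∈ S, D.tail a ≠ some v

/-- `j`-root-connectivity: `d⁻(S) ≥ j` for all nonempty `S ⊆ V`. -/
def RootConnected (j : ℕ) : Prop :=
  ∀ S : Finset V, S.Nonempty → j ≤ (D.entering S).card

/-- The set `N⁺(v)` of out-neighbours of a vertex `v ∈ V + r`. -/
def outNeighbors (v : Option V) : Finset V :=
  (Finset.univ.filter fun a => D.tail a = v).image D.head

/-- A vertex is large if it has at least `20 k² + 1` out-neighbours. -/
def IsLarge (k : ℕ) (v : Option V) : Prop :=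
  20 * k ^ 2 + 1 ≤ (D.outNeighbors v).card

/-- A vertex is a sink if no arc leaves it. -/
def IsSink (v : Option V) : Prop :=
  ∀ a, D.tail a ≠ v

/-- There are at most two arcs in the same direction between the same two vertices. -/
def TripleFree : Prop :=
  ∀ (u : Option V) (v : V),
    (Finset.univ.filter fun a => D.tail a = u ∧ D.head a = v).card ≤ 2

/-- `z` is an `(r, c)`-branching flow in `D`: it is at most `c`, the root sends out
`|V| = n - 1` units (no arc enters the root), and each `v ∈ V` absorbs exactly one unit. -/
def IsBranchingFlow (c z : A → ℕ) : Prop :=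
  (∀ a, z a ≤ c a) ∧
  (∑ a with D.tail a = none, z a) = Fintype.card V ∧
  ∀ v : V, (∑ a with D.head a = v, z a) = (∑ a with D.tail a = some v, z a) + 1

/-- `D` is an `(r, k)`-flow branching: it has a branching flow for the constant capacity `n - k`,
where `n = |V| + 1` is the number of vertices of `D` itself. -/
def IsFlowBranching (k : ℕ) : Prop :=
  ∃ z : A → ℕ, D.IsBranchingFlow (fun _ => Fintype.card V + 1 - k) z

/-- The digraph `D - S` for a set `S` of arcs. -/
def deleteArcs (S : Finset A) : RootedDigraph V {a : A // a ∉ S} where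
  tail a := D.tail a
  head a := D.head a
  loopless a := D.loopless a

end Basic

/-- A subdigraph `(V' + r, A')` of `D` (containing the root). -/
structure Subdigraph {V A : Type*} (D : RootedDigraph V A) where
  verts : Finset V
  arcs : Finset A
  head_mem : ∀ a ∈ arcs, D.head a ∈ verts
  tail_mem : ∀ a ∈ arcs, ∀ v ∈ D.tail a, v ∈ verts

namespace Subdigraph

variable {V A : Type*} {D : RootedDigraph V A}

/-- A subdigraph as a rooted digraph in its own right. -/
def toDigraph (X : D.Subdigraph) : RootedDigraph X.verts X.arcs where
  tail a := (D.tail a).pmap Subtype.mk (X.tail_mem a a.2)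
  head a := ⟨D.head a, X.head_mem a a.2⟩
  loopless a h := by
    rw [Option.pmap_eq_some_iff] at h
    obtain ⟨v, _, hv, hh⟩ := h
    rw [Subtype.mk.injEq] at hh
    exact D.loopless a (hh ▸ hv)

/-- The digraph obtained from `X` by adding `j` new vertices and, for the `i`-th of them, one new
arc from the vertex `f i` of `X` to it. -/
def attach (X : D.Subdigraph) {j : ℕ} (f : Fin j → X.verts) :
    RootedDigraph (X.verts ⊕ Fin j) (X.arcs ⊕ Fin j) where
  tail := Sum.elim (fun a => (X.toDigraph.tail a).map Sum.inl) (fun i => some (Sum.inl (f i)))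
  head := Sum.elim (fun a => Sum.inl (X.toDigraph.head a)) Sum.inr
  loopless a h := by
    rcases a with a | i
    · simp only [Sum.elim_inl, Option.map_eq_some_iff] at h
      obtain ⟨v, hv, hh⟩ := h
      exact X.toDigraph.loopless a (Sum.inl_injective hh ▸ hv)
    · simp at h

variable [Fintype V] [Fintype A] [DecidableEq V] [DecidableEq A]

/-- A compact `(r, k)`-core of `D`: a subdigraph `X = (V' + r, A')` with `|V'| ≤ 2k - 1` such that
all large vertices (with respect to `D`) in `V'` are sinks of `X`, and such that an
`(r, k)`-flow branching `Y`, not necessarily a subdigraph of `D`, arises from `X` by adding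
`2k - 1 - |V'|` new vertices and one arc to each of them from some large vertex in `V'`. -/
structure IsCompactCore (k : ℕ) (X : D.Subdigraph) : Prop where
  card_le : X.verts.card ≤ 2 * k - 1
  sink_of_large : ∀ v : X.verts, D.IsLarge k (some v.1) → X.toDigraph.IsSink (some v)
  exists_attach : ∃ f : Fin (2 * k - 1 - X.verts.card) → X.verts,
    (∀ i, D.IsLarge k (some (f i).1)) ∧ (X.attach f).IsFlowBranching k

/-- `X` is a spanning `(r, k)`-flow branching of `D`. -/
def IsSpanningFlowBranching (k : ℕ) (X : D.Subdigraph) : Prop :=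
  X.verts = Finset.univ ∧ X.toDigraph.IsFlowBranching k

/-- The pair `(X, Y)` is extendable: `D - A(X)` and `D - A(Y)` are root-connected. -/
def Extendable (X Y : D.Subdigraph) : Prop :=
  (D.deleteArcs X.arcs).RootConnected 1 ∧ (D.deleteArcs Y.arcs).RootConnected 1

/-- Two subdigraphs have no arc in common. -/
def ArcDisjoint (X Y : D.Subdigraph) : Prop :=
  Disjoint X.arcs Y.arcs

end Subdigraph

end RootedDigraph

/-! ### A random access machine with unit costs

The machine has registers and arrays of natural numbers; a (finite) program mentions only finitely
many of them. The only arithmetic operations are addition and truncated subtraction, so with unit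
costs the machine is polynomially equivalent to Turing machines. -/

namespace RAM

/-- A state of the machine: the contents of register `i` and of cell `j` of array `i`. -/
structure State where
  reg : ℕ → ℕ
  arr : ℕ → ℕ → ℕ

/-- Elementary instructions. -/
inductive Instr
  /-- register `i` := the constant `c` -/
  | const (i c : ℕ)
  /-- register `i` := register `j` + register `l` -/
  | add (i j l : ℕ)
  /-- register `i` := register `j` - register `l` (and `0` if this is negative) -/
  | sub (i j l : ℕ)
  /-- register `i` := cell of array `b` whose address is in register `j` -/
  | load (i b j : ℕ)
  /-- cell of array `b` whose address is in register `i` := register `j` -/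
  | store (b i j : ℕ)

/-- The effect of an instruction. -/
def Instr.exec : Instr → State → State
  | .const i c, s => { s with reg := Function.update s.reg i c }
  | .add i j l, s => { s with reg := Function.update s.reg i (s.reg j + s.reg l) }
  | .sub i j l, s => { s with reg := Function.update s.reg i (s.reg j - s.reg l) }
  | .load i b j, s => { s with reg := Function.update s.reg i (s.arr b (s.reg j)) }
  | .store b i j, s =>
      { s with arr := Function.update s.arr b (Function.update (s.arr b) (s.reg i) (s.reg j)) }

/-- Programs. The conditional and the loop test whether register `i` is nonzero. -/
inductive Program
  | instr (c : Instr)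
  | seq (p q : Program)
  | ifNonzero (i : ℕ) (p q : Program)
  | whileNonzero (i : ℕ) (p : Program)

/-- `Runs p s t s'`: started in state `s`, the program `p` halts in state `s'` after exactly
`t` steps, where every instruction and every test counts as one step. -/
inductive Runs : Program → State → ℕ → State → Prop
  | instr (c : Instr) (s : State) : Runs (.instr c) s 1 (c.exec s)
  | seq {p q : Program} {s s' s'' : State} {t t' : ℕ} :
      Runs p s t s' → Runs q s' t' s'' → Runs (.seq p q) s (t + t') s''
  | ifTrue {i : ℕ} {p q : Program} {s s' : State} {t : ℕ} :
      s.reg i ≠ 0 → Runs p s t s' → Runs (.ifNonzero i p q) s (t + 1) s'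
  | ifFalse {i : ℕ} {p q : Program} {s s' : State} {t : ℕ} :
      s.reg i = 0 → Runs q s t s' → Runs (.ifNonzero i p q) s (t + 1) s'
  | whileStop {i : ℕ} {p : Program} {s : State} :
      s.reg i = 0 → Runs (.whileNonzero i p) s 1 s
  | whileStep {i : ℕ} {p : Program} {s s' s'' : State} {t t' : ℕ} :
      s.reg i ≠ 0 → Runs p s t s' → Runs (.whileNonzero i p) s' t' s'' →
        Runs (.whileNonzero i p) s (t + t' + 1) s''

/-- The number of a vertex: `0` for the root, `v + 1` for `v ∈ V = {0, …, n - 1}`. -/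
def vertexCode {n : ℕ} : Option (Fin n) → ℕ
  | none => 0
  | some v => v.1 + 1

/-- A list as an array: its entries, followed by zeros. -/
def arrayOf (l : List ℕ) : ℕ → ℕ :=
  fun i => l.getD i 0

/-- The 0/1-array of length `n` of a subset of `{0, …, n - 1}`. -/
def indicator {n : ℕ} (S : Finset (Fin n)) : ℕ → ℕ :=
  arrayOf (List.ofFn fun i : Fin n => if i ∈ S then 1 else 0)

/-- The initial state for the input `(D, k, X, Y)`, where `V = {0, …, n - 1}` and
`A = {0, …, m - 1}`: registers 0, 1, 2 hold `|V|`, `|A|`, `k`; arrays 0 and 1 hold the tails and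
the heads of the arcs; arrays 2, 3 hold `V(X) - r` and `A(X)`; arrays 4, 5 hold `V(Y) - r` and
`A(Y)`. All else is zero. -/
def inputState {n m : ℕ} (D : RootedDigraph (Fin n) (Fin m)) (k : ℕ) (X Y : D.Subdigraph) :
    State where
  reg := arrayOf [n, m, k]
  arr := fun b => match b with
    | 0 => arrayOf (List.ofFn fun a => vertexCode (D.tail a))
    | 1 => arrayOf (List.ofFn fun a => vertexCode (some (D.head a)))
    | 2 => indicator X.verts
    | 3 => indicator X.arcs
    | 4 => indicator Y.verts
    | 5 => indicator Y.arcs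
    | _ => fun _ => 0

/-- The first `m` cells of array `b` hold the 0/1-array of the set `S` of arcs. -/
def State.Holds {m : ℕ} (s : State) (b : ℕ) (S : Finset (Fin m)) : Prop :=
  ∀ a : Fin m, s.arr b a.1 = if a ∈ S then 1 else 0

end RAM

set_option linter.unusedSectionVars false

/-! By max-flow min-cut, a spanning subdigraph is an (r,k)-flow branching exactly if |S| ≤ d⁻(S)(n −
k) in it for all S ⊆ V. As |V| ≥ 2k − 1 gives 2(n − k) ≥ |V|, this says that every nonempty S is
entered by an arc, and by two arcs if |S| > n − k.

From branchings to cores: inside a spanning flow branching, send only 2k − 1 units with capacity k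
on each arc, and let large vertices absorb any amount. The cut condition survives, and the support
of such a flow is a compact core; the surplus absorbed at large vertices is the number of leaves to
attach there (`exists_flow`, `exists_isCompactCore`). Cores taken from arc-disjoint branchings Z₁,
Z₂ are extendable, because the complement of each contains the other branching, which is
root-connected.

From cores to branchings: enlarge the first core greedily by at most k arcs out of each core vertex
to new vertices, avoiding the other core and keeping the rest of D root-connected. Then do the same
for the second core, avoiding the enlarged first one. If a large vertex still had quota when the
greedy process stops, uncrossing the sets that block its arcs would bound its out-degree by 3(2k −
1)(k + 1) < 20k² + 1 (`Stable.card_outNeighbors_le`). So each large core vertex gets k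
out-neighbours, which is what the imaginary leaves stood for.

Finally the first subdigraph is grown, with effectively unlimited quotas, until it reaches all
vertices; an uncrossing argument in the style of Lovász's proof of Edmonds' branching theorem shows
that it cannot get stuck (`Stable.verts_eq_univ`). The result and its complement are both
root-connected and contain an enlarged core, which yields the cut condition
(`IsCompactCore.isSpanningFlowBranching`).

The construction is greedy, each test being one graph search, so it runs in polynomial time; any
order of additions works. The correctness proof is stated for arbitrary greedy runs, and the machine
program is only shown to perform one. -/

namespace RootedDigraph

/-! ### Flows and cut conditions -/

section Flows

variable {V A : Type*} [Fintype V] [Fintype A] [DecidableEq V] [DecidableEq A]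
  (D : RootedDigraph V A)

/-- The arc `a` enters the vertex set `S`. -/
def Enters (a : A) (S : Finset V) : Prop :=
  D.head a ∈ S ∧ ∀ v ∈ S, D.tail a ≠ some v

variable {D}

theorem mem_entering {a : A} {S : Finset V} : a ∈ D.entering S ↔ D.Enters a S := by
  simp [entering, Enters]

open Classical in
theorem sum_entering (c : A → ℕ) (S : Finset V) :
    ∑ a ∈ D.entering S, c a = ∑ a, if D.Enters a S then c a else 0 := by
  rw [← Finset.sum_filter]
  exact Finset.sum_congr (by ext; simp [mem_entering]) fun _ _ => rfl

/-- Submodularity, checked arc by arc: only arcs between S \ T and T \ S make a difference. This is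
what lets tight sets be uncrossed. -/
theorem sum_entering_inter_add_union_le (c : A → ℕ) (S T : Finset V) :
    ∑ a ∈ D.entering (S ∩ T), c a + ∑ a ∈ D.entering (S ∪ T), c a ≤
      ∑ a ∈ D.entering S, c a + ∑ a ∈ D.entering T, c a := by
  classical
  simp only [sum_entering, ← Finset.sum_add_distrib]
  refine Finset.sum_le_sum fun a _ => ?_
  rcases h : D.tail a with _ | u
  · by_cases h1 : D.head a ∈ S <;> by_cases h2 : D.head a ∈ T <;> simp [Enters, h, h1, h2]
  · have key : ∀ R : Finset V, (∀ v ∈ R, some u ≠ some v) ↔ u ∉ R := fun R => by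
      simp only [ne_eq, Option.some.injEq]
      exact ⟨fun h hu => h u hu rfl, fun h v hv huv => h (huv ▸ hv)⟩
    by_cases h1 : D.head a ∈ S <;> by_cases h2 : D.head a ∈ T <;> by_cases h3 : u ∈ S <;>
      by_cases h4 : u ∈ T <;> simp only [Enters, h, key] <;> simp [h1, h2, h3, h4]

theorem card_compl_inter_add_card_compl_union (S T : Finset V) :
    ((S ∩ T)ᶜ).card + ((S ∪ T)ᶜ).card = (Sᶜ).card + (Tᶜ).card := by
  rw [Finset.compl_inter, Finset.compl_union, Finset.card_union_add_card_inter]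

/-- A form of the max-flow min-cut theorem: if every cut has room for `T` units, of which each
vertex outside `L` may absorb one and each vertex of `L` arbitrarily many, then `T` units can be
sent from the root, in such a way that no flow leaves `L` and every vertex outside `L` that is
passed absorbs one unit. -/
theorem exists_flow (L : Finset V) (T : ℕ) (c₀ : A → ℕ)
    (h : ∀ S, L ⊆ S → T ≤ ∑ a ∈ D.entering S, c₀ a + (Sᶜ).card) :
    ∃ c : A → ℕ, (∀ a, c a ≤ c₀ a) ∧ (∑ a with D.tail a = none, c a) = T ∧
      (∀ v ∈ L, ∀ a, D.tail a = some v → c a = 0) ∧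
      ∀ v ∉ L, (∑ a with D.head a = v, c a) ≤ (∑ a with D.tail a = some v, c a) + 1 ∧
        ((∑ a with D.tail a = some v, c a) ≠ 0 →
          (∑ a with D.head a = v, c a) = (∑ a with D.tail a = some v, c a) + 1) := by
  classical
  let P : (A → ℕ) → Prop := fun c => (∀ a, c a ≤ c₀ a) ∧
    ∀ S, L ⊆ S → T ≤ ∑ a ∈ D.entering S, c a + (Sᶜ).card
  -- No augmenting paths are needed: a capacity function of minimal total that still satisfies the
  -- cut condition is itself the flow.
  obtain ⟨c, ⟨hc₀, hc⟩, hmin⟩ : ∃ c, P c ∧ ∀ c', P c' → ∑ a, c a ≤ ∑ a, c' a := by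
    have hex : ∃ N, ∃ c, P c ∧ ∑ a, c a = N := ⟨_, c₀, ⟨fun _ => le_rfl, h⟩, rfl⟩
    obtain ⟨c, hPc, hcN⟩ := Nat.find_spec hex
    exact ⟨c, hPc, fun c' hc' => hcN ▸ Nat.find_min' hex ⟨c', hc', rfl⟩⟩
  let Tight : Finset V → Prop := fun S => L ⊆ S ∧ ∑ a ∈ D.entering S, c a + (Sᶜ).card = T
  have tight_of_pos : ∀ a, c a ≠ 0 → ∃ S, Tight S ∧ D.Enters a S := by
    intro a ha
    by_contra! hno
    -- If no tight set were entered by `a`, its capacity could be lowered by one, against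
    -- minimality.
    have hP : P (Function.update c a (c a - 1)) := by
      refine ⟨fun b => ?_, fun S hS => ?_⟩
      · by_cases hb : b = a
        · subst hb; simp; have := hc₀ b; omega
        · simp [hb, hc₀ b]
      · by_cases haS : a ∈ D.entering S
        · have h1 : ∑ b ∈ D.entering S, Function.update c a (c a - 1) b + 1 =
              ∑ b ∈ D.entering S, c b := by
            rw [Finset.sum_update_of_mem haS, ← Finset.add_sum_erase _ c haS,
              Finset.sdiff_singleton_eq_erase]
            omega
          have h2 := hc S hS
          have h3 : ¬ Tight S := fun ht => hno S ht (mem_entering.1 haS)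
          have h4 : ¬ (∑ a ∈ D.entering S, c a + (Sᶜ).card = T) := fun h => h3 ⟨hS, h⟩
          omega
        · rw [Finset.sum_update_of_notMem haS]
          exact hc S hS
    have h1 := hmin _ hP
    rw [Finset.sum_update_of_mem (Finset.mem_univ a), ← Finset.add_sum_erase _ c
      (Finset.mem_univ a), Finset.sdiff_singleton_eq_erase] at h1
    omega
  have tight_inter_union : ∀ S S', Tight S → Tight S' → Tight (S ∩ S') ∧ Tight (S ∪ S') := by
    rintro S S' ⟨hL, hS⟩ ⟨hL', hS'⟩
    have h1 := sum_entering_inter_add_union_le (D := D) c S S'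
    have h2 := card_compl_inter_add_card_compl_union S S'
    have h3 := hc _ (Finset.subset_inter hL hL')
    have h4 := hc (S ∪ S') (hL.trans Finset.subset_union_left)
    exact ⟨⟨Finset.subset_inter hL hL', by omega⟩,
      ⟨hL.trans Finset.subset_union_left, by omega⟩⟩
  -- a tight set avoiding a common tail and containing all heads
  have tight_out : ∀ u : Option V, (∑ a with D.tail a = u, c a) ≠ 0 →
      ∃ S, Tight S ∧ (∀ x ∈ S, u ≠ some x) ∧ ∀ a, D.tail a = u → c a ≠ 0 → D.head a ∈ S := by
    intro u hu
    obtain ⟨a₀, ha₀, hca₀⟩ := Finset.exists_ne_zero_of_sum_ne_zero hu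
    obtain ⟨S₀, hS₀, he₀⟩ := tight_of_pos a₀ hca₀
    simp only [Finset.mem_filter, Finset.mem_univ, true_and] at ha₀
    -- A largest tight set avoiding `u` absorbs, by unions, the tight set of every positive arc
    -- leaving `u`.
    let F := Finset.univ.filter fun S : Finset V => Tight S ∧ ∀ x ∈ S, u ≠ some x
    obtain ⟨S, hS, hmax⟩ := F.exists_max_image Finset.card
      ⟨S₀, by simp only [F, Finset.mem_filter, Finset.mem_univ, true_and]
              exact ⟨hS₀, ha₀ ▸ he₀.2⟩⟩
    simp only [F, Finset.mem_filter, Finset.mem_univ, true_and] at hS hmax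
    refine ⟨S, hS.1, hS.2, fun a ha hca => ?_⟩
    obtain ⟨S', hS', he'⟩ := tight_of_pos a hca
    have h1 := hmax (S ∪ S') ⟨(tight_inter_union S S' hS.1 hS').2, fun x hx => by
      rcases Finset.mem_union.1 hx with hx | hx
      · exact hS.2 x hx
      · exact ha ▸ he'.2 x hx⟩
    rw [Finset.eq_of_subset_of_card_le Finset.subset_union_left h1]
    exact Finset.mem_union_right _ he'.1
  -- a tight set containing a common head and avoiding all tails
  have tight_in : ∀ v : V, (∑ a with D.head a = v, c a) ≠ 0 →
      ∃ S, Tight S ∧ v ∈ S ∧ ∀ a, D.head a = v → c a ≠ 0 → D.Enters a S := by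
    intro v hv
    obtain ⟨a₀, ha₀, hca₀⟩ := Finset.exists_ne_zero_of_sum_ne_zero hv
    obtain ⟨S₀, hS₀, he₀⟩ := tight_of_pos a₀ hca₀
    simp only [Finset.mem_filter, Finset.mem_univ, true_and] at ha₀
    let F := Finset.univ.filter fun S : Finset V => Tight S ∧ v ∈ S
    obtain ⟨S, hS, hmax⟩ := F.exists_min_image Finset.card
      ⟨S₀, by simp only [F, Finset.mem_filter, Finset.mem_univ, true_and]
              exact ⟨hS₀, ha₀ ▸ he₀.1⟩⟩
    simp only [F, Finset.mem_filter, Finset.mem_univ, true_and] at hS hmax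
    refine ⟨S, hS.1, hS.2, fun a ha hca => ⟨ha ▸ hS.2, fun x hx => ?_⟩⟩
    obtain ⟨S', hS', he'⟩ := tight_of_pos a hca
    have h1 := hmax (S ∩ S') ⟨(tight_inter_union S S' hS.1 hS').1,
      Finset.mem_inter.2 ⟨hS.2, ha ▸ he'.1⟩⟩
    rw [← Finset.eq_of_subset_of_card_le Finset.inter_subset_left h1] at hx
    exact he'.2 x (Finset.mem_inter.1 hx).2
  refine ⟨c, hc₀, ?_, ?_, ?_⟩
  -- The cut S = V gives at least T units out of the root; a tight set that all these arcs enter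
  -- gives at most T.
  · have h1 := hc Finset.univ (Finset.subset_univ L)
    have h2 : D.entering Finset.univ = Finset.univ.filter fun a => D.tail a = none := by
      ext a
      simp [mem_entering, Enters, Option.eq_none_iff_forall_ne_some]
    rw [h2] at h1
    simp only [Finset.compl_univ, Finset.card_empty, add_zero] at h1
    by_cases h0 : (∑ a with D.tail a = none, c a) = 0
    · omega
    · obtain ⟨S, hS, -, hin⟩ := tight_out none h0
      refine le_antisymm ?_ h1
      calc (∑ a with D.tail a = none, c a) ≤ ∑ a ∈ D.entering S, c a := by
            refine Finset.sum_le_sum_of_ne_zero fun a ha hca => ?_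
            simp only [Finset.mem_filter, Finset.mem_univ, true_and] at ha
            exact mem_entering.2 ⟨hin a ha hca, by simp [ha]⟩
        _ ≤ T := by have := hS.2; omega
  · intro v hv a ha
    by_contra hca
    obtain ⟨S, hS, he⟩ := tight_of_pos a hca
    exact he.2 v (hS.1 hv) ha
  · intro v hv
    have hle : (∑ a with D.head a = v, c a) ≤ (∑ a with D.tail a = some v, c a) + 1 := by
      by_cases h0 : (∑ a with D.head a = v, c a) = 0
      · omega
      obtain ⟨S, ⟨hLS, hS⟩, hvS, hin⟩ := tight_in v h0
      -- Compare the tight set S, entered by all positive arcs into `v`, with S − v: the cut value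
      -- falls by at least inflow minus outflow, while the complement grows by one.
      have h1 := hc (S.erase v) (Finset.subset_erase.2 ⟨hLS, hv⟩)
      have h2 : ((S.erase v)ᶜ).card = (Sᶜ).card + 1 := by
        rw [Finset.compl_erase, Finset.card_insert_of_notMem (by simpa using hvS)]
      have h3 : ∑ a ∈ D.entering (S.erase v), c a + (∑ a with D.head a = v, c a) ≤
          ∑ a ∈ D.entering S, c a + (∑ a with D.tail a = some v, c a) := by
        simp only [sum_entering, Finset.sum_filter, ← Finset.sum_add_distrib]
        refine Finset.sum_le_sum fun a _ => ?_
        by_cases hca : c a = 0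
        · simp [hca]
        by_cases ha : D.head a = v
        · have h5 : ¬ D.Enters a (S.erase v) := fun h => Finset.notMem_erase v S (ha ▸ h.1)
          simp [ha, hin a ha hca, h5]
        · by_cases hb : D.tail a = some v
          · simp only [ha, hb, if_false, if_true]
            split_ifs <;> omega
          · have h5 : D.Enters a (S.erase v) → D.Enters a S := by
              rintro ⟨h6, h7⟩
              refine ⟨Finset.mem_of_mem_erase h6, fun x hx hax => ?_⟩
              by_cases hxv : x = v
              · exact hb (hxv ▸ hax)
              · exact h7 x (Finset.mem_erase.2 ⟨hxv, hx⟩) hax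
            by_cases h6 : D.Enters a (S.erase v)
            · simp [ha, hb, h6, h5 h6]
            · simp [ha, hb, h6]
      omega
    refine ⟨hle, fun h0 => le_antisymm hle ?_⟩
    obtain ⟨S, ⟨hLS, hS⟩, hvS, hin⟩ := tight_out (some v) h0
    have hvS : v ∉ S := fun h => hvS v h rfl
    -- Dually, passing from S to S + v loses one unit of complement, so the cut value must rise by
    -- at least one.
    have h1 := hc (insert v S) (hLS.trans (Finset.subset_insert v S))
    have h2 : (Sᶜ).card = ((insert v S)ᶜ).card + 1 := by
      rw [Finset.compl_insert, Finset.card_erase_add_one (by simpa using hvS)]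
    have h3 : ∑ a ∈ D.entering (insert v S), c a + (∑ a with D.tail a = some v, c a) ≤
        ∑ a ∈ D.entering S, c a + (∑ a with D.head a = v, c a) := by
      simp only [sum_entering, Finset.sum_filter, ← Finset.sum_add_distrib]
      refine Finset.sum_le_sum fun a _ => ?_
      by_cases hca : c a = 0
      · simp [hca]
      by_cases hb : D.tail a = some v
      · have h5 : D.Enters a S := ⟨hin a hb hca, fun x hx hax => hvS (by
          rw [hb, Option.some.injEq] at hax; exact hax ▸ hx)⟩
        have h6 : ¬ D.Enters a (insert v S) := fun h => h.2 v (Finset.mem_insert_self _ _) hb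
        simp [hb, h5, h6]
      · by_cases ha : D.head a = v
        · simp only [ha, hb, if_false, if_true]
          split_ifs <;> omega
        · have h5 : D.Enters a (insert v S) → D.Enters a S := fun h6 =>
            ⟨(Finset.mem_insert.1 h6.1).resolve_left ha,
              fun x hx => h6.2 x (Finset.mem_insert_of_mem hx)⟩
          by_cases h6 : D.Enters a (insert v S)
          · simp [ha, hb, h6, h5 h6]
          · simp [ha, hb, h6]
    omega

theorem sum_head_eq_sum_tail (z : A → ℕ) :
    ∑ v, ∑ a with D.head a = v, z a =
      (∑ a with D.tail a = none, z a) + ∑ v, ∑ a with D.tail a = some v, z a := by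
  rw [Finset.sum_fiberwise, ← Fintype.sum_option (fun u => ∑ a with D.tail a = u, z a),
    Finset.sum_fiberwise]

/-- Add up the conservation equations over S: arcs inside S occur on both sides, so the |S| absorbed
units must come through the cut. -/
theorem IsBranchingFlow.card_le {c z : A → ℕ} (hz : D.IsBranchingFlow c z) (S : Finset V) :
    S.card ≤ ∑ a ∈ D.entering S, c a := by
  classical
  have h1 : ∑ v ∈ S, ∑ a with D.head a = v, z a =
      ∑ v ∈ S, (∑ a with D.tail a = some v, z a) + S.card := by
    rw [Finset.card_eq_sum_ones, ← Finset.sum_add_distrib]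
    exact Finset.sum_congr rfl fun v _ => hz.2.2 v
  have h2 : ∑ v ∈ S, ∑ a with D.head a = v, z a ≤
      ∑ v ∈ S, (∑ a with D.tail a = some v, z a) + ∑ a ∈ D.entering S, z a := by
    simp only [sum_entering, Finset.sum_filter]
    rw [Finset.sum_comm, Finset.sum_comm (s := S), ← Finset.sum_add_distrib]
    refine Finset.sum_le_sum fun a _ => ?_
    rw [Finset.sum_ite_eq]
    by_cases ha : D.head a ∈ S
    · by_cases he : D.Enters a S
      · simp [ha, he]
      · have : ∃ v ∈ S, D.tail a = some v := by
          by_contra! h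
          exact he ⟨ha, h⟩
        obtain ⟨v, hv, hav⟩ := this
        simp only [ha, he, if_true, if_false, add_zero]
        refine le_trans ?_ (Finset.single_le_sum (fun _ _ => Nat.zero_le _) hv)
        simp [hav]
    · simp [ha]
  have h3 : ∑ a ∈ D.entering S, z a ≤ ∑ a ∈ D.entering S, c a :=
    Finset.sum_le_sum fun a _ => hz.1 a
  omega

theorem IsFlowBranching.card_le {k : ℕ} (hD : D.IsFlowBranching k) (S : Finset V) :
    S.card ≤ (D.entering S).card * (Fintype.card V + 1 - k) := by
  obtain ⟨z, hz⟩ := hD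
  simpa using hz.card_le S

/-- Take L = ∅ and T = |V| in `exists_flow`. Every vertex then absorbs at most one unit and |V|
units are sent out, so every vertex absorbs exactly one. -/
theorem isFlowBranching_of_card_le {k : ℕ}
    (h : ∀ S : Finset V, S.card ≤ (D.entering S).card * (Fintype.card V + 1 - k)) :
    D.IsFlowBranching k := by
  obtain ⟨z, hz, hr, -, hv⟩ := exists_flow (D := D) ∅ (Fintype.card V)
    (fun _ => Fintype.card V + 1 - k) (fun S _ => by
      have := h S
      have := Finset.card_add_card_compl S
      simp only [Finset.sum_const, smul_eq_mul]
      omega)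
  refine ⟨z, hz, hr, ?_⟩
  have h1 := sum_head_eq_sum_tail (D := D) z
  have h2 : ∑ v, ∑ a with D.head a = v, z a = ∑ v : V, ((∑ a with D.tail a = some v, z a) + 1) := by
    rw [h1, hr, Finset.sum_add_distrib]
    simp [add_comm]
  intro v
  exact (Finset.sum_eq_sum_iff_of_le fun v _ => (hv v (by simp)).1).1 h2 v (Finset.mem_univ v)

end Flows

end RootedDigraph

namespace RootedDigraph

namespace Subdigraph

/-! ### Compact cores inside spanning flow branchings -/

section Basic

variable {V A : Type*} [Fintype V] [Fintype A] [DecidableEq V] [DecidableEq A]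
  {D : RootedDigraph V A}

theorem toDigraph_tail_eq_some {X : D.Subdigraph} {a : X.arcs} {v : X.verts} :
    X.toDigraph.tail a = some v ↔ D.tail a = some v.1 := by
  simp only [toDigraph, Option.pmap_eq_some_iff]
  constructor
  · rintro ⟨w, _, h, rfl⟩
    exact h
  · intro h
    exact ⟨v.1, v.2, h, rfl⟩

theorem toDigraph_tail_eq_none {X : D.Subdigraph} {a : X.arcs} :
    X.toDigraph.tail a = none ↔ D.tail a = none := by
  simp [toDigraph]

theorem toDigraph_head {X : D.Subdigraph} {a : X.arcs} {v : X.verts} :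
    X.toDigraph.head a = v ↔ D.head a = v.1 := by
  simp [toDigraph, Subtype.ext_iff]

theorem toDigraph_enters {X : D.Subdigraph} {a : X.arcs} {S : Finset V} :
    X.toDigraph.Enters a (S.subtype (· ∈ X.verts)) ↔ D.Enters a S := by
  simp only [Enters, Finset.mem_subtype, ne_eq, toDigraph_tail_eq_some, Subtype.forall]
  refine and_congr Iff.rfl ⟨fun h v hv hav => ?_, fun h v _ hv => h v hv⟩
  exact h v (X.tail_mem a a.2 v hav) hv hav

theorem card_toDigraph_entering (X : D.Subdigraph) (S : Finset V) :
    (X.toDigraph.entering (S.subtype (· ∈ X.verts))).card =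
      ((D.entering S).filter (· ∈ X.arcs)).card := by
  rw [← Finset.card_map (Function.Embedding.subtype _)]
  congr 1
  ext a
  simp only [Finset.mem_map, mem_entering, Function.Embedding.coe_subtype, Finset.mem_filter,
    toDigraph_enters]
  constructor
  · rintro ⟨b, hb, rfl⟩
    exact ⟨hb, b.2⟩
  · rintro ⟨h, ha⟩
    exact ⟨⟨a, ha⟩, h, rfl⟩

theorem card_subtype_of_verts_eq_univ {X : D.Subdigraph} (hX : X.verts = Finset.univ)
    (S : Finset V) : (S.subtype (· ∈ X.verts)).card = S.card := by
  rw [Finset.card_subtype]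
  simp [hX]

/-- Spanning flow branchings in terms of cuts. -/
theorem isSpanningFlowBranching_iff {X : D.Subdigraph} {k : ℕ} :
    X.IsSpanningFlowBranching k ↔ X.verts = Finset.univ ∧
      ∀ S : Finset V,
        S.card ≤ ((D.entering S).filter (· ∈ X.arcs)).card * (Fintype.card V + 1 - k) := by
  refine and_congr_right fun hX => ?_
  have hcard : Fintype.card X.verts = Fintype.card V := by simp [hX]
  constructor
  · intro h S
    have := h.card_le (S.subtype (· ∈ X.verts))
    rwa [card_toDigraph_entering, card_subtype_of_verts_eq_univ hX, hcard] at this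
  · intro h
    refine isFlowBranching_of_card_le fun S => ?_
    have hS : S = (S.map (Function.Embedding.subtype _)).subtype (· ∈ X.verts) := by
      ext x
      simp
    rw [hcard, hS, card_toDigraph_entering, card_subtype_of_verts_eq_univ hX]
    exact h _

section Attach

variable {X : D.Subdigraph} {j : ℕ} {f : Fin j → X.verts}

theorem attach_tail_inl_eq_none {a : X.arcs} :
    (X.attach f).tail (Sum.inl a) = none ↔ D.tail a = none := by
  simp [attach, toDigraph_tail_eq_none]

theorem attach_tail_inl_eq_some {a : X.arcs} {v : X.verts} :
    (X.attach f).tail (Sum.inl a) = some (Sum.inl v) ↔ D.tail a = some v.1 := by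
  simp [attach, toDigraph_tail_eq_some]

theorem attach_tail_inl_ne {a : X.arcs} {i : Fin j} :
    (X.attach f).tail (Sum.inl a) ≠ some (Sum.inr i) := by
  simp [attach]

theorem attach_tail_inr {i : Fin j} :
    (X.attach f).tail (Sum.inr i) = some (Sum.inl (f i)) := rfl

theorem attach_head_inl_eq {a : X.arcs} {v : X.verts} :
    (X.attach f).head (Sum.inl a) = Sum.inl v ↔ D.head a = v.1 := by
  simp [attach, toDigraph_head]

theorem attach_head_inl_ne {a : X.arcs} {i : Fin j} :
    (X.attach f).head (Sum.inl a) ≠ Sum.inr i := by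
  simp [attach]

theorem attach_head_inr {i : Fin j} : (X.attach f).head (Sum.inr i) = Sum.inr i := rfl

end Attach

/-- Every spanning flow branching contains a compact core. -/
theorem IsSpanningFlowBranching.exists_isCompactCore {k : ℕ} (hk : 1 ≤ k)
    (hV : 2 * k - 1 ≤ Fintype.card V) {Z : D.Subdigraph} (hZ : Z.IsSpanningFlowBranching k) :
    ∃ X : D.Subdigraph, X.arcs ⊆ Z.arcs ∧ X.IsCompactCore k := by
  classical
  obtain ⟨-, hcut⟩ := isSpanningFlowBranching_iff.1 hZ
  let L : Finset V := Finset.univ.filter fun v => D.IsLarge k (some v)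
  have hL : ∀ v, v ∈ L ↔ D.IsLarge k (some v) := fun v => by simp [L]
  obtain ⟨c, hck, hr, hlarge, hsmall⟩ := exists_flow (D := D) L (2 * k - 1)
    (fun a => if a ∈ Z.arcs then k else 0) (fun S _ => by
      rw [← Finset.sum_filter, Finset.sum_const, smul_eq_mul]
      have h1 := hcut S
      have h2 := Finset.card_add_card_compl S
      generalize ((D.entering S).filter (· ∈ Z.arcs)).card = d at h1 ⊢
      -- Write d for the number of entering arcs in Z. If d = 0, then S = ∅ and its complement has
      -- |V| ≥ 2k − 1 elements. If d = 1, then |S| ≤ n − k leaves k − 1 vertices outside, giving k +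
      -- (k − 1). If d ≥ 2, the capacity alone is at least 2k.
      rcases d with _ | _ | d
      · omega
      · simp only [zero_add, one_mul] at h1 ⊢
        omega
      · have : 2 * k ≤ (d + 1 + 1) * k := Nat.mul_le_mul_right _ (by omega)
        omega)
  have hin : ∀ a, c a ≠ 0 → (∑ b with D.head b = D.head a, c b) ≠ 0 := fun a ha h0 =>
    ha (Finset.sum_eq_zero_iff.1 h0 a (by simp))
  have hout : ∀ a v, D.tail a = some v → c a ≠ 0 → (∑ b with D.tail b = some v, c b) ≠ 0 :=
    fun a v hav ha h0 => ha (Finset.sum_eq_zero_iff.1 h0 a (by simp [hav]))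
  let X : D.Subdigraph :=
    { verts := Finset.univ.filter fun v => (∑ b with D.head b = v, c b) ≠ 0
      arcs := Finset.univ.filter fun a => c a ≠ 0
      head_mem := fun a ha => by
        simp only [Finset.mem_filter, Finset.mem_univ, true_and] at ha ⊢
        exact hin a ha
      tail_mem := fun a ha v hv => by
        simp only [Finset.mem_filter, Finset.mem_univ, true_and] at ha ⊢
        have hvL : v ∉ L := fun h => ha (hlarge v h a hv)
        have := (hsmall v hvL).2 (hout a v hv ha)
        omega }
  have hXv : ∀ v, v ∈ X.verts ↔ (∑ b with D.head b = v, c b) ≠ 0 := fun v => by simp [X]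
  have hXa : ∀ a, a ∈ X.arcs ↔ c a ≠ 0 := fun a => by simp [X]
  -- the number of leaves to be attached to `v`
  let e : V → ℕ := fun v => (∑ b with D.head b = v, c b) - (∑ b with D.tail b = some v, c b) - 1
  have outL : ∀ v ∈ L, (∑ b with D.tail b = some v, c b) = 0 := fun v hv =>
    Finset.sum_eq_zero fun a ha => hlarge v hv a (by simpa using ha)
  have he : ∀ v ∈ X.verts, (∑ b with D.head b = v, c b) =
      (∑ b with D.tail b = some v, c b) + e v + 1 := by
    intro v hv
    have h1 := (hXv v).1 hv
    simp only [e]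
    by_cases hvL : v ∈ L
    · have := outL v hvL
      omega
    · have := hsmall v hvL
      omega
  have hnot : ∀ v ∉ X.verts, (∑ b with D.head b = v, c b) = 0 ∧
      (∑ b with D.tail b = some v, c b) = 0 := by
    intro v hv
    have h1 : (∑ b with D.head b = v, c b) = 0 := by
      by_contra h
      exact hv ((hXv v).2 h)
    refine ⟨h1, ?_⟩
    by_cases hvL : v ∈ L
    · exact outL v hvL
    · have := hsmall v hvL
      omega
  have hsum : ∑ v ∈ X.verts, e v + X.verts.card = 2 * k - 1 := by
    have h1 := sum_head_eq_sum_tail (D := D) c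
    rw [hr] at h1
    have h2 : ∑ v, ∑ a with D.head a = v, c a = ∑ v ∈ X.verts, ∑ a with D.head a = v, c a :=
      (Finset.sum_subset (Finset.subset_univ _) fun v _ hv => (hnot v hv).1).symm
    have h3 : ∑ v, ∑ a with D.tail a = some v, c a =
        ∑ v ∈ X.verts, ∑ a with D.tail a = some v, c a :=
      (Finset.sum_subset (Finset.subset_univ _) fun v _ hv => (hnot v hv).2).symm
    rw [h2, h3, Finset.sum_congr rfl he, Finset.sum_add_distrib, Finset.sum_add_distrib] at h1
    simp only [Finset.sum_const, smul_eq_mul, mul_one] at h1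
    omega
  have hcardσ : Fintype.card (Σ v : X.verts, Fin (e v.1)) = 2 * k - 1 - X.verts.card := by
    rw [Fintype.card_sigma]
    simp only [Fintype.card_fin]
    rw [Finset.sum_coe_sort X.verts e]
    omega
  -- Distributes the 2k − 1 − |V'| new leaves so that exactly `e v` of them hang on `v`.
  let φ := (Fintype.equivFinOfCardEq hcardσ).symm
  have hfib : ∀ v : X.verts, (Finset.univ.filter fun i => (φ i).1 = v).card = e v.1 := by
    intro v
    rw [← Fintype.card_fin (e v.1), ← Finset.card_univ, ← Finset.card_map
      (⟨fun x => (⟨v, x⟩ : Σ v : X.verts, Fin (e v.1)), fun _ _ h => by simpa using h⟩ : Fin (e v.1) ↪ _),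
      ← Finset.card_map φ.toEmbedding]
    congr 1
    ext ⟨w, x⟩
    simp only [Finset.mem_map, Finset.mem_filter, Finset.mem_univ, true_and,
      Function.Embedding.coeFn_mk]
    constructor
    · rintro ⟨i, rfl, hi⟩
      rw [hi]
      exact ⟨x, rfl⟩
    · rintro ⟨y, hy⟩
      refine ⟨φ.symm ⟨w, x⟩, ?_, by simp⟩
      rw [Equiv.apply_symm_apply, ← hy]
      rfl
  have sumX : ∀ (p : A → Prop) [DecidablePred p], (∑ a : X.arcs, if p a then c a else 0) = ∑ a with p a, c a := by
    intro p _
    rw [Finset.sum_coe_sort X.arcs (fun a => if p a then c a else 0),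
      Finset.sum_filter p]
    refine Finset.sum_subset (Finset.subset_univ _) fun a _ ha => ?_
    rw [hXa, not_not] at ha
    simp [ha]
  refine ⟨X, fun a ha => ?_, by omega, ?_, fun i => (φ i).1, fun i => ?_,
    Sum.elim (fun a => c a) (fun _ => 1), ?_, ?_, ?_⟩
  · by_contra h
    have := hck a
    rw [if_neg h] at this
    exact (hXa a).1 ha (by omega)
  · intro v hv a ha
    rw [toDigraph_tail_eq_some] at ha
    exact (hXa a).1 a.2 (hlarge v ((hL v).2 hv) a ha)
  -- Leaves hang on large vertices only: any other vertex absorbs at most one unit, so its surplus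
  -- `e` is zero.
  · rw [← hL]
    by_contra h
    have h1 := he _ (φ i).1.2
    have h2 := (hsmall _ h).1
    have h3 := (φ i).2.2
    dsimp only at h1 h2
    omega
  -- The completed digraph has 2k vertices including the root, so its capacity is 2k − k = k, the
  -- one used for the flow.
  · have hcap : Fintype.card (X.verts ⊕ Fin (2 * k - 1 - X.verts.card)) + 1 - k = k := by
      simp only [Fintype.card_sum, Fintype.card_coe, Fintype.card_fin]
      omega
    intro a
    rw [hcap]
    rcases a with a | i
    · refine (hck a).trans ?_
      dsimp only
      split_ifs <;> omega
    · exact hk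
  · rw [Finset.sum_filter, Fintype.sum_sum_type]
    simp only [attach_tail_inl_eq_none, attach_tail_inr, Sum.elim_inl, reduceCtorEq, if_false,
      Finset.sum_const_zero, add_zero]
    rw [sumX (fun a => D.tail a = none), hr]
    simp only [Fintype.card_sum, Fintype.card_coe, Fintype.card_fin]
    omega
  · rintro (v | i)
    · simp only [Finset.sum_filter, Fintype.sum_sum_type, attach_tail_inl_eq_some,
        attach_tail_inr, attach_head_inl_eq, attach_head_inr, Sum.elim_inl, Sum.elim_inr,
        reduceCtorEq, if_false, Finset.sum_const_zero, add_zero, Option.some.injEq,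
        Sum.inl.injEq]
      rw [sumX (fun a => D.head a = v), sumX (fun a => D.tail a = some v.1), he v.1 v.2,
        ← hfib v, Finset.card_filter]
    · simp [Finset.sum_filter, attach_tail_inl_ne, attach_tail_inr, attach_head_inl_ne,
        attach_head_inr]

end Basic

end Subdigraph

end RootedDigraph

namespace RootedDigraph

/-! ### Greedy enlargement that keeps the rest root-connected -/

section Growth

variable {V A : Type*} [Fintype V] [Fintype A] [DecidableEq V] [DecidableEq A]
  {D : RootedDigraph V A}

theorem rootConnected_deleteArcs_one {B : Finset A} :
    (D.deleteArcs B).RootConnected 1 ↔ ∀ S : Finset V, S.Nonempty → ∃ a ∉ B, D.Enters a S := by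
  refine forall₂_congr fun S _ => ?_
  rw [Nat.one_le_iff_ne_zero, Finset.card_ne_zero]
  constructor
  · rintro ⟨a, ha⟩
    exact ⟨a.1, a.2, (mem_entering (D := D.deleteArcs B)).1 ha⟩
  · rintro ⟨a, ha, he⟩
    exact ⟨⟨a, ha⟩, (mem_entering (D := D.deleteArcs B)).2 he⟩

theorem RootConnected.exists_ne_enters (hD : D.RootConnected 2) {S : Finset V} (hS : S.Nonempty)
    (a : A) : ∃ b, b ≠ a ∧ D.Enters b S := by
  obtain ⟨b, hb, hne⟩ := Finset.exists_mem_ne (hD S hS) a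
  exact ⟨b, hne, mem_entering.1 hb⟩

theorem Enters.of_inter {a : A} {S T : Finset V} (h : D.Enters a (S ∩ T)) :
    D.Enters a S ∨ D.Enters a T := by
  obtain ⟨h1, h2⟩ := h
  rw [Finset.mem_inter] at h1
  by_contra! hno
  obtain ⟨hS, hT⟩ := hno
  simp only [Enters, h1, true_and, not_forall, not_not] at hS hT
  obtain ⟨u, hu, hau⟩ := hS
  obtain ⟨w, hw, haw⟩ := hT
  obtain rfl : u = w := by rw [hau] at haw; simpa using haw
  exact h2 u (Finset.mem_inter.2 ⟨hu, hw⟩) hau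

theorem Enters.of_union {a : A} {S T : Finset V} (h : D.Enters a (S ∪ T)) :
    D.Enters a S ∨ D.Enters a T :=
  (Finset.mem_union.1 h.1).imp
    (fun h1 => ⟨h1, fun v hv => h.2 v (Finset.mem_union_left _ hv)⟩)
    (fun h1 => ⟨h1, fun v hv => h.2 v (Finset.mem_union_right _ hv)⟩)

/-- A set left without entering arcs once `a` is deleted too. Such sets are the only obstruction to
an otherwise admissible arc. -/
theorem exists_enters_unique {B : Finset A} {a : A}
    (h : (D.deleteArcs B).RootConnected 1)
    (h' : ¬ (D.deleteArcs (insert a B)).RootConnected 1) :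
    ∃ S, D.Enters a S ∧ ∀ e ∉ B, D.Enters e S → e = a := by
  rw [rootConnected_deleteArcs_one] at h h'
  push Not at h'
  obtain ⟨S, hS, hno⟩ := h'
  have key : ∀ e ∉ B, D.Enters e S → e = a := fun e he heS => by
    by_contra hne
    exact hno e (by simp [hne, he]) heS
  obtain ⟨e, he, heS⟩ := h S hS
  exact ⟨S, key e he heS ▸ heS, key⟩

/-- A stage of the greedy enlargement of a subdigraph: its arcs, its vertices other than the root,
and the number of arcs that may still be added at each tail. -/
structure Growth (V A : Type*) where
  arcs : Finset A
  verts : Finset V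
  quota : Option V → ℕ

namespace Growth

/-- The arc `a` may be added to `s`, the arcs of `F` being forbidden. -/
def Addable (D : RootedDigraph V A) (F : Finset A) (s : Growth V A) (a : A) : Prop :=
  s.quota (D.tail a) ≠ 0 ∧ D.head a ∉ s.verts ∧ a ∉ F ∧
    (D.deleteArcs (insert a s.arcs)).RootConnected 1

/-- The arc `a` and its head are added to `s`, and the head gets the quota `h`. -/
def add (D : RootedDigraph V A) (h : ℕ) (s : Growth V A) (a : A) : Growth V A where
  arcs := insert a s.arcs
  verts := insert (D.head a) s.verts
  quota := Function.update (Function.update s.quota (D.tail a) (s.quota (D.tail a) - 1))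
    (some (D.head a)) h

/-- `s'` arises from `s` by adding arcs one by one. -/
def Grows (D : RootedDigraph V A) (F : Finset A) (h : ℕ) : Growth V A → Growth V A → Prop :=
  Relation.ReflTransGen fun s s' => ∃ a, s.Addable D F a ∧ s' = s.add D h a

/-- No arc may be added to `s`. -/
def Stable (D : RootedDigraph V A) (F : Finset A) (s : Growth V A) : Prop :=
  ∀ a, ¬ s.Addable D F a

/-- Each addition puts a new vertex into the finite set `verts`. -/
theorem exists_stable (D : RootedDigraph V A) (F : Finset A) (h : ℕ) (s : Growth V A) :
    ∃ s', Grows D F h s s' ∧ s'.Stable D F := by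
  induction hn : (s.vertsᶜ).card using Nat.strong_induction_on generalizing s with
  | _ n ih =>
    by_cases hs : s.Stable D F
    · exact ⟨s, Relation.ReflTransGen.refl, hs⟩
    · simp only [Stable, not_forall, not_not] at hs
      obtain ⟨a, ha⟩ := hs
      have hlt : (((s.add D h a).verts)ᶜ).card < n := by
        rw [← hn]
        refine Finset.card_lt_card ?_
        rw [Finset.compl_ssubset_compl]
        exact Finset.ssubset_insert ha.2.1
      obtain ⟨s', hs', hst⟩ := ih _ hlt _ rfl
      exact ⟨s', Relation.ReflTransGen.head ⟨a, ha, rfl⟩ hs', hst⟩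

theorem Grows.preserves {F : Finset A} {h : ℕ} {s s' : Growth V A} (hg : Grows D F h s s')
    (P : Growth V A → Prop) (hP : ∀ s a, P s → s.Addable D F a → P (s.add D h a)) (hs : P s) :
    P s' := by
  induction hg with
  | refl => exact hs
  | tail _ hstep ih =>
    obtain ⟨a, ha, rfl⟩ := hstep
    exact hP _ a ih ha

/-- The properties of a subdigraph that are maintained when arcs are added. -/
structure Valid (D : RootedDigraph V A) (F : Finset A) (s : Growth V A) : Prop where
  disjoint : Disjoint s.arcs F
  conn : (D.deleteArcs s.arcs).RootConnected 1
  head_mem : ∀ a ∈ s.arcs, D.head a ∈ s.verts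
  quota_mem : ∀ v, s.quota (some v) ≠ 0 → v ∈ s.verts
  reach : ∀ S : Finset V, (∃ v ∈ S, v ∈ s.verts) → ∃ a ∈ s.arcs, D.Enters a S

/-- For `reach`, the tail of the new arc has positive quota, so it is the root or an old vertex;
hence the arc enters every set that contains its head but no old vertex. -/
theorem Valid.add {F : Finset A} {h : ℕ} {s : Growth V A} {a : A} (hs : s.Valid D F)
    (ha : s.Addable D F a) : (s.add D h a).Valid D F where
  disjoint := Finset.disjoint_insert_left.2 ⟨ha.2.2.1, hs.disjoint⟩
  conn := ha.2.2.2
  head_mem := fun b hb => by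
    rcases Finset.mem_insert.1 hb with rfl | hb
    · exact Finset.mem_insert_self _ _
    · exact Finset.mem_insert_of_mem (hs.head_mem b hb)
  quota_mem := fun v hv => by
    by_cases hva : v = D.head a
    · exact hva ▸ Finset.mem_insert_self _ _
    · refine Finset.mem_insert_of_mem (hs.quota_mem v fun h0 => hv ?_)
      simp only [Growth.add, Function.update_apply, Option.some.injEq, hva, if_false]
      split_ifs with h1
      · rw [← h1, h0]
      · exact h0
  reach := fun S hS => by
    by_cases h1 : ∃ v ∈ S, v ∈ s.verts
    · obtain ⟨b, hb, he⟩ := hs.reach S h1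
      exact ⟨b, Finset.mem_insert_of_mem hb, he⟩
    · push Not at h1
      obtain ⟨v, hvS, hv⟩ := hS
      rcases Finset.mem_insert.1 hv with rfl | hv
      · exact ⟨a, Finset.mem_insert_self _ _, hvS, fun u hu hau =>
          h1 u hu (hs.quota_mem u (hau ▸ ha.1))⟩
      · exact absurd hv (h1 v hvS)

theorem Grows.valid {F : Finset A} {h : ℕ} {s s' : Growth V A} (hg : Grows D F h s s')
    (hs : s.Valid D F) : s'.Valid D F :=
  hg.preserves (Valid D F) (fun _ _ h h' => h.add h') hs

theorem Grows.arcs_subset {F : Finset A} {h : ℕ} {s s' : Growth V A} (hg : Grows D F h s s') :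
    s.arcs ⊆ s'.arcs :=
  hg.preserves (fun t => s.arcs ⊆ t.arcs)
    (fun _ _ h _ => h.trans (Finset.subset_insert _ _)) subset_rfl

/-- In a stable stage, a vertex with a positive quota has few out-neighbours. -/
theorem Stable.card_outNeighbors_le (hD : D.RootConnected 2) {F : Finset A} {s : Growth V A}
    (hs : s.Valid D F) (hst : s.Stable D F) {R : Finset V} (hR : ∀ a ∈ F, D.head a ∈ R) {v : V}
    (hv : s.quota (some v) ≠ 0) :
    (D.outNeighbors (some v)).card ≤ R.card + 2 * s.verts.card := by
  classical
  -- An arc from `v` to a bad `w` fails only the connectivity test, so it is the sole arc outside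
  -- `s.arcs` entering some S(w). By 2-root-connectivity an arc of `s.arcs` also enters S(w); its
  -- head is x(w).
  let bad := (D.outNeighbors (some v)) \ (R ∪ s.verts)
  have hbad : ∀ w ∈ bad, ∃ (a : A) (S : Finset V), D.tail a = some v ∧ D.head a = w ∧
      D.Enters a S ∧ (∀ e ∉ s.arcs, D.Enters e S → e = a) ∧ ∃ x ∈ s.verts, x ∈ S := by
    intro w hw
    simp only [bad, outNeighbors, Finset.mem_sdiff, Finset.mem_image, Finset.mem_filter,
      Finset.mem_univ, true_and, Finset.mem_union, not_or] at hw
    obtain ⟨⟨a, ha, rfl⟩, hwR, hws⟩ := hw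
    have hnc : ¬ (D.deleteArcs (insert a s.arcs)).RootConnected 1 := fun hc =>
      hst a ⟨ha ▸ hv, hws, fun haF => hwR (hR a haF), hc⟩
    obtain ⟨S, hS, huniq⟩ := exists_enters_unique hs.conn hnc
    obtain ⟨e, hne, he⟩ := hD.exists_ne_enters ⟨_, hS.1⟩ a
    have heB : e ∈ s.arcs := by
      by_contra h
      exact hne (huniq e h he)
    exact ⟨a, S, ha, rfl, hS, huniq, D.head e, hs.head_mem e heB, he.1⟩
  choose! a S hta hha hent huniq x hx hxS using hbad
  -- If x(w) = x(w'), the intersection of S(w) and S(w') is nonempty and entered by an arc outside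
  -- `s.arcs`, which must be one of the two blocked arcs. Having the common tail `v`, it enters both
  -- sets and so equals the other.
  have hinj : Set.InjOn x (bad : Set V) := by
    intro w hw w' hw' hxx
    rw [Finset.mem_coe] at hw hw'
    obtain ⟨e, heB, he⟩ := rootConnected_deleteArcs_one.1 hs.conn (S w ∩ S w')
      ⟨x w, Finset.mem_inter.2 ⟨hxS w hw, hxx ▸ hxS w' hw'⟩⟩
    have hmem := Finset.mem_inter.1 he.1
    rcases he.of_inter with h | h
    · have h1 := huniq w hw e heB h
      have h2 : D.Enters (a w hw) (S w') := ⟨h1 ▸ hmem.2, fun u hu hau =>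
        (hent w' hw').2 u hu (by rw [hta w' hw', ← hta w hw, hau])⟩
      have h3 := huniq w' hw' (a w hw) (h1 ▸ heB) h2
      rw [← hha w hw, ← hha w' hw', h3]
    · have h1 := huniq w' hw' e heB h
      have h2 : D.Enters (a w' hw') (S w) := ⟨h1 ▸ hmem.1, fun u hu hau =>
        (hent w hw).2 u hu (by rw [hta w hw, ← hta w' hw', hau])⟩
      have h3 := huniq w hw (a w' hw') (h1 ▸ heB) h2
      rw [← hha w hw, ← hha w' hw', h3]
  have h1 : bad.card ≤ s.verts.card := Finset.card_le_card_of_injOn x hx hinj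
  have h2 : (D.outNeighbors (some v)).card ≤ bad.card + (R ∪ s.verts).card :=
    (Finset.card_le_card fun w hw => by
      rw [Finset.union_comm, Finset.mem_union, Finset.mem_sdiff]
      tauto).trans (Finset.card_union_le (D.outNeighbors (some v) \ (R ∪ s.verts)) _)
  have h3 := Finset.card_union_le R s.verts
  omega

/-- In a stable stage, all vertices have been reached if no quota is exhausted. -/
theorem Stable.verts_eq_univ (hD : D.RootConnected 2) {F : Finset A} {s : Growth V A}
    (hs : s.Valid D F) (hst : s.Stable D F) {R : Finset V} (hR : ∀ a ∈ F, D.head a ∈ R)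
    (hF : (D.deleteArcs F).RootConnected 1)
    (hreach : ∀ S : Finset V, (∃ v ∈ S, v ∈ R) → ∃ a ∈ F, D.Enters a S)
    (hq : s.verts ≠ Finset.univ →
      s.quota none ≠ 0 ∧ ∀ v ∈ s.verts, s.quota (some v) ≠ 0) :
    s.verts = Finset.univ := by
  classical
  by_contra hne
  obtain ⟨hq0, hqv⟩ := hq hne
  -- an arc leaving the current vertex set is blocked by a tight set
  have tight : ∀ a, a ∉ F → D.head a ∉ s.verts →
      (∀ u, D.tail a = some u → u ∈ s.verts) →
      ∃ S : Finset V, D.Enters a S ∧ (∀ e ∉ s.arcs, D.Enters e S → e = a) ∧ ∀ v ∈ S, v ∉ R := by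
    intro a haF hha hta
    have hnc : ¬ (D.deleteArcs (insert a s.arcs)).RootConnected 1 := fun hc => by
      refine hst a ⟨?_, hha, haF, hc⟩
      rcases h : D.tail a with _ | u
      · exact hq0
      · exact hqv u (hta u h)
    obtain ⟨S, hS, huniq⟩ := exists_enters_unique hs.conn hnc
    -- If S met R, an arc of F would enter S; not lying in `s.arcs`, it would have to be `a`, which
    -- is not in F.
    refine ⟨S, hS, huniq, fun v hvS hvR => ?_⟩
    obtain ⟨e, heF, he⟩ := hreach S ⟨v, hvS, hvR⟩
    exact haF (huniq e (Finset.disjoint_right.1 hs.disjoint heF) he ▸ heF)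
  -- Uniqueness of the entering arc suffices here; existence always follows from `hs.conn`. A
  -- minimal set of this kind will be made smaller.
  let P : Finset V → Prop := fun S =>
    (∃ a, ∀ e ∉ s.arcs, D.Enters e S → e = a) ∧ (∀ v ∈ S, v ∉ R) ∧ ∃ v ∈ S, v ∉ s.verts
  obtain ⟨S, hS, hmin⟩ : ∃ S, P S ∧ ∀ S', P S' → S.card ≤ S'.card := by
    have hex : (Finset.univ.filter P).Nonempty := by
      obtain ⟨a, haF, ha⟩ := rootConnected_deleteArcs_one.1 hF (s.vertsᶜ) (by
        rw [Finset.nonempty_iff_ne_empty, Ne, Finset.compl_eq_empty_iff]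
        exact hne)
      have hha : D.head a ∉ s.verts := by simpa using ha.1
      obtain ⟨S, h1, h2, h3⟩ := tight a haF hha fun u hu => by
        by_contra h
        exact ha.2 u (by simpa using h) hu
      exact ⟨S, by simpa using ⟨⟨a, h2⟩, h3, D.head a, h1.1, hha⟩⟩
    obtain ⟨S, hS, hmin⟩ := Finset.exists_min_image _ Finset.card hex
    exact ⟨S, by simpa using hS, fun S' hS' => hmin S' (by simpa using hS')⟩
  obtain ⟨⟨a₀, ha₀⟩, hSR, v, hvS, hv⟩ := hS
  -- The second arc entering the unreached part of S must start in the reached part of S, for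
  -- otherwise it would enter S and equal `a₀`.
  obtain ⟨a, hne₀, ha⟩ := hD.exists_ne_enters (S := S \ s.verts)
    ⟨v, Finset.mem_sdiff.2 ⟨hvS, hv⟩⟩ a₀
  have hha := Finset.mem_sdiff.1 ha.1
  have haB : a ∉ s.arcs := fun h => hha.2 (hs.head_mem a h)
  have haF : a ∉ F := fun h => hSR _ hha.1 (hR a h)
  obtain ⟨u, huS, hau⟩ : ∃ u ∈ S, D.tail a = some u := by
    by_contra! h
    exact hne₀ (ha₀ a haB ⟨hha.1, h⟩)
  have hu : u ∈ s.verts := by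
    by_contra h
    exact ha.2 u (Finset.mem_sdiff.2 ⟨huS, h⟩) hau
  obtain ⟨S', hS', huniq, hS'R⟩ := tight a haF hha.2 fun w hw => by
    rw [hau, Option.some.injEq] at hw
    exact hw ▸ hu
  have huS' : u ∉ S' := fun h => hS'.2 u h hau
  have hP : P (S ∩ S') := by
    refine ⟨⟨a, fun e he heS => ?_⟩, fun w hw => hSR w (Finset.mem_inter.1 hw).1,
      D.head a, Finset.mem_inter.2 ⟨hha.1, hS'.1⟩, hha.2⟩
    rcases heS.of_inter with h | h
    · have hea := ha₀ e he h
      subst hea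
      by_cases h1 : D.Enters e S'
      · exact huniq e he h1
      · exfalso
        -- An arc entering the union would be `a₀`, which then also enters S', or `a`, whose tail
        -- `u` lies in S.
        obtain ⟨b, hb, hbe⟩ := rootConnected_deleteArcs_one.1 hs.conn (S ∪ S')
          ⟨u, Finset.mem_union_left _ huS⟩
        rcases hbe.of_union with h2 | h2
        · have := ha₀ b hb h2
          subst this
          exact h1 ⟨(Finset.mem_inter.1 heS.1).2,
            fun w hw => hbe.2 w (Finset.mem_union_right _ hw)⟩
        · have := huniq b hb h2
          subst this
          exact hbe.2 u (Finset.mem_union_left _ huS) hau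
    · exact huniq e he h
  have h1 := hmin _ hP
  have h2 := Finset.eq_of_subset_of_card_le Finset.inter_subset_left h1
  exact huS' (Finset.mem_inter.1 (h2 ▸ huS)).2

end Growth

end Growth

end RootedDigraph

namespace RootedDigraph

/-! ### From extendable cores to flow branchings -/

section Cores

variable {V A : Type*} [Fintype V] [Fintype A] [DecidableEq V] [DecidableEq A]
  {D : RootedDigraph V A}

namespace Subdigraph

/-- The cut condition for the digraph that a compact core is completed to, in terms of the sets
that contain a new vertex if and only if they contain the vertex it is attached to. -/
theorem IsCompactCore.exists_cut {k : ℕ} (hk : 1 ≤ k) {X : D.Subdigraph}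
    (hX : X.IsCompactCore k) :
    ∃ f : Fin (2 * k - 1 - X.verts.card) → X.verts, (∀ i, D.IsLarge k (some (f i).1)) ∧
      ∀ S : Finset V, (X.verts ∩ S).card + (Finset.univ.filter fun i => (f i).1 ∈ S).card ≤
        ((D.entering S).filter (· ∈ X.arcs)).card * k := by
  obtain ⟨f, hf, hY⟩ := hX.exists_attach
  refine ⟨f, hf, fun S => ?_⟩
  -- Together with the leaves attached to it, S is entered by no new arc, so only arcs of X cross
  -- this cut.
  have h1 := hY.card_le
    ((S.subtype (· ∈ X.verts)).disjSum (Finset.univ.filter fun i => (f i).1 ∈ S))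
  have hcap : Fintype.card (X.verts ⊕ Fin (2 * k - 1 - X.verts.card)) + 1 - k ≤ k := by
    have := hX.card_le
    simp only [Fintype.card_sum, Fintype.card_coe, Fintype.card_fin]
    omega
  have h2 : (S.subtype (· ∈ X.verts)).card = (X.verts ∩ S).card := by
    rw [Finset.card_subtype, Finset.inter_comm, Finset.filter_mem_eq_inter]
  rw [Finset.card_disjSum, h2] at h1
  refine h1.trans (Nat.mul_le_mul ?_ hcap)
  rw [← Finset.card_subtype, ← Finset.card_map (Function.Embedding.inl :
    X.arcs ↪ X.arcs ⊕ Fin (2 * k - 1 - X.verts.card))]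
  refine Finset.card_le_card fun e he => ?_
  obtain ⟨he1, he2⟩ := mem_entering.1 he
  rcases e with a | i
  · simp only [Finset.mem_map, Finset.mem_subtype, mem_entering]
    refine ⟨a, ⟨by simpa [attach, toDigraph] using he1, fun u hu hau => ?_⟩, rfl⟩
    have huX := X.tail_mem a a.2 u hau
    exact he2 (Sum.inl ⟨u, huX⟩) (by simpa using hu) (attach_tail_inl_eq_some.2 hau)
  · rw [attach_head_inr, Finset.inr_mem_disjSum, Finset.mem_filter] at he1
    exact absurd attach_tail_inr (he2 (Sum.inl (f i)) (by simpa using he1.2))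

theorem IsCompactCore.exists_enters {k : ℕ} (hk : 1 ≤ k) {X : D.Subdigraph}
    (hX : X.IsCompactCore k) {S : Finset V} (hS : ∃ v ∈ S, v ∈ X.verts) :
    ∃ a ∈ X.arcs, D.Enters a S := by
  obtain ⟨f, -, hcut⟩ := hX.exists_cut hk
  obtain ⟨v, hvS, hv⟩ := hS
  have h1 := hcut S
  have h2 : 0 < (X.verts ∩ S).card := Finset.card_pos.2 ⟨v, Finset.mem_inter.2 ⟨hv, hvS⟩⟩
  have h3 : 0 < ((D.entering S).filter (· ∈ X.arcs)).card := by
    by_contra h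
    rw [Nat.eq_zero_of_not_pos h, zero_mul] at h1
    omega
  obtain ⟨a, ha⟩ := Finset.card_pos.1 h3
  rw [Finset.mem_filter, mem_entering] at ha
  exact ⟨a, ha.2, ha.1⟩

/-- The spanning subdigraph with the arc set `B`. -/
def spanning (D : RootedDigraph V A) (B : Finset A) : D.Subdigraph where
  verts := Finset.univ
  arcs := B
  head_mem _ _ := Finset.mem_univ _
  tail_mem _ _ _ _ := Finset.mem_univ _

/-- The heads of the arcs of `B` with tail `v`. -/
def outs (D : RootedDigraph V A) (B : Finset A) (v : V) : Finset V :=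
  (B.filter fun a => D.tail a = some v).image D.head

/-- A root-connected spanning subdigraph that contains a compact core and at least `k` heads of
arcs leaving each large vertex of this core is a flow branching. -/
theorem IsCompactCore.isSpanningFlowBranching {k : ℕ} (hk : 1 ≤ k)
    (hV : 2 * k - 1 ≤ Fintype.card V) {X : D.Subdigraph} (hX : X.IsCompactCore k)
    {B : Finset A} (hB : X.arcs ⊆ B)
    (hlarge : ∀ v ∈ X.verts, D.IsLarge k (some v) → k ≤ (outs D B v).card)
    (hconn : ∀ S : Finset V, S.Nonempty → ∃ a ∈ B, D.Enters a S) :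
    (spanning D B).IsSpanningFlowBranching k := by
  refine isSpanningFlowBranching_iff.2 ⟨rfl, fun S => ?_⟩
  change S.card ≤ ((D.entering S).filter (· ∈ B)).card * _
  have hS := Finset.card_add_card_compl S
  rcases S.eq_empty_or_nonempty with rfl | hne
  · simp
  have hpos : 1 ≤ ((D.entering S).filter (· ∈ B)).card := by
    obtain ⟨a, ha, he⟩ := hconn S hne
    exact Finset.card_pos.2 ⟨a, Finset.mem_filter.2 ⟨mem_entering.2 he, ha⟩⟩
  by_cases hsmall : S.card ≤ Fintype.card V + 1 - k
  · exact hsmall.trans (Nat.le_mul_of_pos_left _ hpos)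
  -- Now at most k − 2 vertices lie outside S, and two arcs suffice because 2(n − k) ≥ |V|.
  suffices h2 : 2 ≤ ((D.entering S).filter (· ∈ B)).card by
    refine le_trans ?_ (Nat.mul_le_mul_right _ h2)
    omega
  -- A large core vertex outside S sends arcs to k vertices, of which at least two lie in S. If
  -- there is none, S contains every vertex with attached leaves, and the core cut bounds d·k below
  -- by (2k − 1) − (k − 2) = k + 1.
  by_cases hex : ∃ v ∈ X.verts, D.IsLarge k (some v) ∧ v ∉ S
  · obtain ⟨v, hvX, hvl, hvS⟩ := hex
    have h1 := hlarge v hvX hvl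
    have h2 : (outs D B v).card ≤ (outs D B v ∩ S).card + (Sᶜ).card := by
      rw [← Finset.card_inter_add_card_sdiff (outs D B v) S]
      refine Nat.add_le_add_left (Finset.card_le_card fun w hw => ?_) _
      simpa using (Finset.mem_sdiff.1 hw).2
    have h3 : (outs D B v ∩ S).card ≤ ((D.entering S).filter (· ∈ B)).card := by
      refine (Finset.card_le_card fun w hw => ?_).trans
        (Finset.card_image_le (s := (D.entering S).filter (· ∈ B)) (f := D.head))
      simp only [outs, Finset.mem_inter, Finset.mem_image, Finset.mem_filter] at hw
      obtain ⟨⟨a, ⟨haB, ha⟩, rfl⟩, haS⟩ := hw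
      refine Finset.mem_image_of_mem _ (Finset.mem_filter.2 ⟨mem_entering.2 ⟨haS, ?_⟩, haB⟩)
      intro u hu hau
      rw [ha, Option.some.injEq] at hau
      exact hvS (hau ▸ hu)
    omega
  · push Not at hex
    obtain ⟨f, hf, hcut⟩ := hX.exists_cut hk
    have h1 := hcut S
    rw [Finset.filter_true_of_mem fun i _ => hex _ (f i).2 (hf i), Finset.card_univ,
      Fintype.card_fin] at h1
    have h2 : X.verts.card ≤ (X.verts ∩ S).card + (Sᶜ).card := by
      rw [← Finset.card_inter_add_card_sdiff X.verts S]
      refine Nat.add_le_add_left (Finset.card_le_card fun w hw => ?_) _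
      simpa using (Finset.mem_sdiff.1 hw).2
    have h3 : ((D.entering S).filter (· ∈ X.arcs)).card ≤
        ((D.entering S).filter (· ∈ B)).card :=
      Finset.card_le_card fun a ha => by
        rw [Finset.mem_filter] at ha ⊢
        exact ⟨ha.1, hB ha.2⟩
    refine le_trans ?_ h3
    by_contra hlt
    have h4 : ((D.entering S).filter (· ∈ X.arcs)).card * k ≤ 1 * k :=
      Nat.mul_le_mul_right _ (by omega)
    omega

end Subdigraph

namespace Growth

open Subdigraph

/-- The stage with arc set `B` and vertex set `R` in which the root has quota `h` and each other
vertex has quota `q`. -/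
def start (B : Finset A) (R : Finset V) (h q : ℕ) : Growth V A where
  arcs := B
  verts := R
  quota u := u.elim h fun v => if v ∈ R then q else 0

theorem valid_start_core {k : ℕ} (hk : 1 ≤ k) {X : D.Subdigraph} (hX : X.IsCompactCore k)
    {F : Finset A} (hF : Disjoint X.arcs F) (hc : (D.deleteArcs X.arcs).RootConnected 1) :
    (start X.arcs X.verts 0 k).Valid D F where
  disjoint := hF
  conn := hc
  head_mem := X.head_mem
  quota_mem v hv := by
    by_contra h
    exact hv (if_neg h)
  reach _ hS := hX.exists_enters hk hS

theorem Valid.restart {F F' : Finset A} {s : Growth V A} (hs : s.Valid D F)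
    (hF : Disjoint s.arcs F') (h q : ℕ) : (start s.arcs s.verts h q).Valid D F' where
  disjoint := hF
  conn := hs.conn
  head_mem := hs.head_mem
  quota_mem v hv := by
    by_contra h
    exact hv (if_neg h)
  reach := hs.reach

/-- New vertices get quota 0, so each addition pays for one vertex with one unit of quota. -/
theorem Grows.card_add_sum_quota_le {k : ℕ} {X : D.Subdigraph} {F : Finset A} {s : Growth V A}
    (hg : Grows D F 0 (start X.arcs X.verts 0 k) s) :
    s.verts.card + ∑ u, s.quota u ≤ X.verts.card * (k + 1) := by
  refine hg.preserves (fun t => t.verts.card + ∑ u, t.quota u ≤ X.verts.card * (k + 1)) ?_ ?_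
  · intro t a ht ha
    have h1 : (t.add D 0 a).verts.card = t.verts.card + 1 := Finset.card_insert_of_notMem ha.2.1
    have h2 : ∑ u, (t.add D 0 a).quota u + 1 ≤ ∑ u, t.quota u := by
      refine Nat.succ_le_of_lt (Finset.sum_lt_sum (fun u _ => ?_) ⟨D.tail a, Finset.mem_univ _, ?_⟩)
      · simp only [Growth.add, Function.update_apply]
        split_ifs with h1 h2
        · exact Nat.zero_le _
        · rw [h2]
          exact Nat.sub_le _ _
        · exact le_rfl
      · simp only [Growth.add, Function.update_apply]
        have := ha.1
        split_ifs <;> omega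
    omega
  · rw [Fintype.sum_option]
    simp only [start, Option.elim_none, Option.elim_some, zero_add]
    rw [Finset.sum_ite_mem, Finset.univ_inter, Finset.sum_const, smul_eq_mul]
    exact le_of_eq (by ring)

/-- Each unit of quota spent at `v` buys a head that is new, hence not yet counted. -/
theorem Grows.le_quota_add_card_outs {k : ℕ} {X : D.Subdigraph} {F : Finset A}
    {s : Growth V A} (hg : Grows D F 0 (start X.arcs X.verts 0 k) s) :
    ∀ v ∈ X.verts, k ≤ s.quota (some v) + (outs D s.arcs v).card := by
  refine (hg.preserves (fun t => (X.verts ⊆ t.verts ∧ ∀ a ∈ t.arcs, D.head a ∈ t.verts) ∧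
    ∀ v ∈ X.verts, k ≤ t.quota (some v) + (outs D t.arcs v).card) ?_ ?_).2
  · rintro t a ⟨⟨h1, h2⟩, h3⟩ ha
    refine ⟨⟨h1.trans (Finset.subset_insert _ _), fun b hb => ?_⟩, fun v hv => ?_⟩
    · rcases Finset.mem_insert.1 hb with rfl | hb
      · exact Finset.mem_insert_self _ _
      · exact Finset.mem_insert_of_mem (h2 b hb)
    · have hva : v ≠ D.head a := fun h => ha.2.1 (h ▸ h1 hv)
      refine (h3 v hv).trans ?_
      simp only [Growth.add, Function.update_apply, Option.some.injEq, hva, if_false]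
      by_cases hav : some v = D.tail a
      · have h4 : outs D (insert a t.arcs) v = insert (D.head a) (outs D t.arcs v) := by
          simp [outs, Finset.filter_insert, ← hav]
        have h5 : D.head a ∉ outs D t.arcs v := by
          simp only [outs, Finset.mem_image, Finset.mem_filter, not_exists, not_and]
          exact fun b hb hba => ha.2.1 (hba ▸ h2 b hb.1)
        rw [h4, Finset.card_insert_of_notMem h5, if_pos hav, hav]
        omega
      · rw [if_neg hav]
        refine Nat.add_le_add_left (Finset.card_le_card (Finset.image_subset_image
          (Finset.filter_subset_filter _ (Finset.subset_insert _ _)))) _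
  · refine ⟨⟨subset_rfl, X.head_mem⟩, fun v hv => ?_⟩
    simp [start, hv]

/-- When no more leaves can be attached to a compact core, each of its large vertices is the tail
of arcs to at least `k` vertices. -/
theorem le_card_outs {k : ℕ} (hk : 1 ≤ k) (hD : D.RootConnected 2) {X : D.Subdigraph}
    (hX : X.IsCompactCore k) {F : Finset A} {s : Growth V A}
    (hg : Grows D F 0 (start X.arcs X.verts 0 k) s) (hs : s.Valid D F) (hst : s.Stable D F)
    {R : Finset V} (hR : ∀ a ∈ F, D.head a ∈ R) (hRc : R.card ≤ (2 * k - 1) * (k + 1)) :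
    ∀ v ∈ X.verts, D.IsLarge k (some v) → k ≤ (outs D s.arcs v).card := by
  intro v hv hvl
  have h1 := hg.le_quota_add_card_outs v hv
  by_cases h0 : s.quota (some v) = 0
  · omega
  exfalso
  have h2 := hst.card_outNeighbors_le hD hs hR h0
  have h3 := hg.card_add_sum_quota_le
  have h4 : X.verts.card * (k + 1) ≤ (2 * k - 1) * (k + 1) := Nat.mul_le_mul_right _ hX.card_le
  -- Both |R| and |`s.verts`| are at most (2k − 1)(k + 1), and `s.verts` counts twice.
  have h5 : 20 * k ^ 2 + 1 ≤ 3 * ((2 * k - 1) * (k + 1)) := hvl.trans (by omega)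
  obtain ⟨k, rfl⟩ : ∃ l, k = l + 1 := ⟨k - 1, by omega⟩
  have h6 : 2 * (k + 1) - 1 = 2 * k + 1 := by omega
  rw [h6] at h5
  nlinarith

/-- The three enlargements of an extendable pair of compact cores result in two arc-disjoint
spanning flow branchings. -/
theorem isSpanningFlowBranching_of_grows {k : ℕ} (hk : 1 ≤ k) (hD : D.RootConnected 2)
    (hV : 2 * k - 1 ≤ Fintype.card V) {X₁ X₂ : D.Subdigraph} (hdisj : X₁.ArcDisjoint X₂)
    (hext : X₁.Extendable X₂) (hX₁ : X₁.IsCompactCore k) (hX₂ : X₂.IsCompactCore k)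
    {s₁ s₂ s₃ : Growth V A}
    (hg₁ : Grows D X₂.arcs 0 (start X₁.arcs X₁.verts 0 k) s₁) (hst₁ : s₁.Stable D X₂.arcs)
    (hg₂ : Grows D s₁.arcs 0 (start X₂.arcs X₂.verts 0 k) s₂) (hst₂ : s₂.Stable D s₁.arcs)
    (hg₃ : Grows D s₂.arcs (Fintype.card V + 1)
      (start s₁.arcs s₁.verts (Fintype.card V + 1) (Fintype.card V + 1)) s₃)
    (hst₃ : s₃.Stable D s₂.arcs) :
    (spanning D s₃.arcs).IsSpanningFlowBranching k ∧
      (spanning D s₃.arcsᶜ).IsSpanningFlowBranching k := by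
  have hs₁ := hg₁.valid (valid_start_core hk hX₁ hdisj hext.1)
  have hs₂ := hg₂.valid (valid_start_core hk hX₂
    (Finset.disjoint_left.2 fun a ha h => Finset.disjoint_left.1 hs₁.disjoint h ha) hext.2)
  have hs₃ := hg₃.valid (hs₁.restart hs₂.disjoint.symm _ _)
  have hl₁ := le_card_outs hk hD hX₁ hg₁ hs₁ hst₁ X₂.head_mem
    (hX₂.card_le.trans (Nat.le_mul_of_pos_right _ (Nat.succ_pos _)))
  have hl₂ := le_card_outs hk hD hX₂ hg₂ hs₂ hst₂ hs₁.head_mem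
    ((Nat.le_add_right _ _).trans (hg₁.card_add_sum_quota_le.trans
      (Nat.mul_le_mul_right _ hX₁.card_le)))
  -- A quota of |V| + 1 cannot run out: at most one unit is spent per vertex gained.
  have hq := hg₃.preserves (fun t => Fintype.card V + 1 ≤ t.verts.card + t.quota none ∧
      ∀ v ∈ t.verts, Fintype.card V + 1 ≤ t.verts.card + t.quota (some v)) (by
    rintro t a ⟨h1, h2⟩ ha
    have h3 : (t.add D (Fintype.card V + 1) a).verts.card = t.verts.card + 1 :=
      Finset.card_insert_of_notMem ha.2.1
    rw [h3]
    refine ⟨?_, fun v hv => ?_⟩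
    · simp only [Growth.add, Function.update_apply, reduceCtorEq, if_false]
      split_ifs with h4
      · rw [← h4]
        omega
      · omega
    · simp only [Growth.add, Function.update_apply, Option.some.injEq]
      split_ifs with h4 h5
      · omega
      · have := h2 v ((Finset.mem_insert.1 hv).resolve_left h4)
        rw [← h5]
        omega
      · have := h2 v ((Finset.mem_insert.1 hv).resolve_left h4)
        omega) (by
    refine ⟨by simp [start], fun v hv => ?_⟩
    have hv' : v ∈ s₁.verts := hv
    simp [start, hv'])
  have huniv : s₃.verts = Finset.univ := hst₃.verts_eq_univ hD hs₃ hs₂.head_mem hs₂.conn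
    hs₂.reach fun hne => by
      have hlt : s₃.verts.card < Fintype.card V := (Finset.card_lt_iff_ne_univ _).2 hne
      refine ⟨fun h => ?_, fun v hv h => ?_⟩
      · have := hq.1
        omega
      · have := hq.2 v hv
        omega
  have hsub₁ : s₁.arcs ⊆ s₃.arcs := hg₃.arcs_subset
  have hsub₂ : s₂.arcs ⊆ s₃.arcsᶜ := fun a ha =>
    Finset.mem_compl.2 (Finset.disjoint_right.1 hs₃.disjoint ha)
  have houts : ∀ {B B' : Finset A} (v : V), B ⊆ B' → (outs D B v).card ≤ (outs D B' v).card :=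
    fun v h => Finset.card_le_card
      (Finset.image_subset_image (Finset.filter_subset_filter _ h))
  refine ⟨hX₁.isSpanningFlowBranching hk hV (hg₁.arcs_subset.trans hsub₁)
    (fun v hv hvl => (hl₁ v hv hvl).trans (houts v hsub₁)) fun S hS => ?_,
    hX₂.isSpanningFlowBranching hk hV (hg₂.arcs_subset.trans hsub₂)
    (fun v hv hvl => (hl₂ v hv hvl).trans (houts v hsub₂)) fun S hS => ?_⟩
  · obtain ⟨v, hv⟩ := hS
    exact hs₃.reach S ⟨v, hv, huniv ▸ Finset.mem_univ v⟩
  · obtain ⟨a, ha, he⟩ := rootConnected_deleteArcs_one.1 hs₃.conn S hS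
    exact ⟨a, Finset.mem_compl.2 ha, he⟩

end Growth

/-- The characterization of digraphs with two arc-disjoint spanning flow branchings. -/
theorem exists_spanningFlowBranchings_iff {k : ℕ} (hk : 1 ≤ k) (hD : D.RootConnected 2)
    (hV : 2 * k - 1 ≤ Fintype.card V) :
    (∃ Z₁ Z₂ : D.Subdigraph, Z₁.ArcDisjoint Z₂ ∧
        Z₁.IsSpanningFlowBranching k ∧ Z₂.IsSpanningFlowBranching k) ↔
      ∃ X₁ X₂ : D.Subdigraph, X₁.ArcDisjoint X₂ ∧ X₁.Extendable X₂ ∧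
        X₁.IsCompactCore k ∧ X₂.IsCompactCore k := by
  constructor
  · rintro ⟨Z₁, Z₂, hdisj, hZ₁, hZ₂⟩
    obtain ⟨X₁, hsub₁, hX₁⟩ := hZ₁.exists_isCompactCore hk hV
    obtain ⟨X₂, hsub₂, hX₂⟩ := hZ₂.exists_isCompactCore hk hV
    -- Deleting arcs outside Z leaves Z, whose cut condition forces an arc into every nonempty set.
    have conn : ∀ {Z : D.Subdigraph} {B : Finset A}, Z.IsSpanningFlowBranching k →
        Disjoint B Z.arcs → (D.deleteArcs B).RootConnected 1 := by
      intro Z B hZ hB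
      refine rootConnected_deleteArcs_one.2 fun S hS => ?_
      have h1 := (Subdigraph.isSpanningFlowBranching_iff.1 hZ).2 S
      have h2 : 0 < ((D.entering S).filter (· ∈ Z.arcs)).card := by
        by_contra h
        rw [Nat.eq_zero_of_not_pos h, zero_mul] at h1
        have := hS.card_pos
        omega
      obtain ⟨a, ha⟩ := Finset.card_pos.1 h2
      rw [Finset.mem_filter, mem_entering] at ha
      exact ⟨a, Finset.disjoint_right.1 hB ha.2, ha.1⟩
    exact ⟨X₁, X₂, Finset.disjoint_of_subset_left hsub₁
      (Finset.disjoint_of_subset_right hsub₂ hdisj),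
      ⟨conn hZ₂ (Finset.disjoint_of_subset_left hsub₁ hdisj),
        conn hZ₁ (Finset.disjoint_of_subset_left hsub₂ (Disjoint.symm hdisj))⟩, hX₁, hX₂⟩
  · rintro ⟨X₁, X₂, hdisj, hext, hX₁, hX₂⟩
    obtain ⟨s₁, hg₁, hst₁⟩ := Growth.exists_stable D X₂.arcs 0
      (Growth.start X₁.arcs X₁.verts 0 k)
    obtain ⟨s₂, hg₂, hst₂⟩ := Growth.exists_stable D s₁.arcs 0
      (Growth.start X₂.arcs X₂.verts 0 k)
    obtain ⟨s₃, hg₃, hst₃⟩ := Growth.exists_stable D s₂.arcs (Fintype.card V + 1)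
      (Growth.start s₁.arcs s₁.verts (Fintype.card V + 1) (Fintype.card V + 1))
    obtain ⟨h₁, h₂⟩ := Growth.isSpanningFlowBranching_of_grows hk hD hV hdisj hext hX₁ hX₂
      hg₁ hst₁ hg₂ hst₂ hg₃ hst₃
    exact ⟨Subdigraph.spanning D s₃.arcs, Subdigraph.spanning D s₃.arcsᶜ,
      disjoint_compl_right (a := s₃.arcs), h₁, h₂⟩

end Cores

end RootedDigraph

/-! ### Correctness and running time rules for programs -/

namespace RAM

/-- Started in `s`, the program `P` halts within `T` steps in a state that satisfies `Q`. -/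
def Ends (P : Program) (s : State) (T : ℕ) (Q : State → Prop) : Prop :=
  ∃ t s', Runs P s t s' ∧ t ≤ T ∧ Q s'

namespace Ends

theorem mono {P : Program} {s : State} {T T' : ℕ} {Q Q' : State → Prop} (h : Ends P s T Q)
    (hT : T ≤ T') (hQ : ∀ s', Q s' → Q' s') : Ends P s T' Q' := by
  obtain ⟨t, s', hr, ht, hq⟩ := h
  exact ⟨t, s', hr, ht.trans hT, hQ s' hq⟩

theorem instr {c : Instr} {s : State} {Q : State → Prop} (h : Q (c.exec s)) :
    Ends (.instr c) s 1 Q :=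
  ⟨1, _, .instr c s, le_rfl, h⟩

theorem seq {p q : Program} {s : State} {T T' : ℕ} {R Q : State → Prop} (hp : Ends p s T R)
    (hq : ∀ s', R s' → Ends q s' T' Q) : Ends (.seq p q) s (T + T') Q := by
  obtain ⟨t, s', hr, ht, hR⟩ := hp
  obtain ⟨t', s'', hr', ht', hQ⟩ := hq s' hR
  exact ⟨t + t', s'', .seq hr hr', by omega, hQ⟩

theorem instr_seq {c : Instr} {q : Program} {s : State} {T : ℕ} {Q : State → Prop}
    (hq : Ends q (c.exec s) T Q) : Ends (.seq (.instr c) q) s (T + 1) Q := by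
  obtain ⟨t, s', hr, ht, hQ⟩ := hq
  exact ⟨1 + t, s', .seq (.instr c s) hr, by omega, hQ⟩

theorem ifNonzero {i : ℕ} {p q : Program} {s : State} {T : ℕ} {Q : State → Prop}
    (hp : s.reg i ≠ 0 → Ends p s T Q) (hq : s.reg i = 0 → Ends q s T Q) :
    Ends (.ifNonzero i p q) s (T + 1) Q := by
  by_cases h : s.reg i = 0
  · obtain ⟨t, s', hr, ht, hQ⟩ := hq h
    exact ⟨t + 1, s', .ifFalse h hr, by omega, hQ⟩
  · obtain ⟨t, s', hr, ht, hQ⟩ := hp h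
    exact ⟨t + 1, s', .ifTrue h hr, by omega, hQ⟩

/-- The rule for loops: `I μ s` says that the invariant holds in `s` and that at most `μ` rounds
remain. -/
theorem whileNonzero {i : ℕ} {p : Program} {T : ℕ} (I : ℕ → State → Prop)
    (hstep : ∀ μ s, I μ s → s.reg i ≠ 0 → Ends p s T fun s' => ∃ μ' < μ, I μ' s')
    {μ : ℕ} {s : State} (h : I μ s) :
    Ends (.whileNonzero i p) s ((T + 1) * μ + 1) fun s' => s'.reg i = 0 ∧ ∃ μ', I μ' s' := by
  induction μ using Nat.strong_induction_on generalizing s with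
  | _ μ ih =>
    by_cases h0 : s.reg i = 0
    · exact ⟨1, s, .whileStop h0, by omega, h0, μ, h⟩
    · obtain ⟨t, s', hr, ht, μ', hlt, hI⟩ := hstep μ s h h0
      obtain ⟨t', s'', hr', ht', hQ⟩ := ih μ' hlt hI
      refine ⟨t + t' + 1, s'', .whileStep h0 hr hr', ?_, hQ⟩
      have : (T + 1) * (μ' + 1) ≤ (T + 1) * μ := Nat.mul_le_mul_left _ hlt
      rw [Nat.mul_add, Nat.mul_one] at this
      omega

end Ends

/-- Execute the given instructions and then `p`. -/
def Program.after (l : List Instr) (p : Program) : Program :=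
  l.foldr (fun c q => .seq (.instr c) q) p

theorem Ends.after {l : List Instr} {p : Program} {s : State} {T : ℕ} {Q : State → Prop}
    (h : Ends p (l.foldl (fun s c => c.exec s) s) T Q) :
    Ends (Program.after l p) s (T + l.length) Q := by
  induction l generalizing s with
  | nil => exact h
  | cons c l ih => exact (Ends.instr_seq (ih h)).mono (by simp) fun _ => id

/-- For all `x` smaller than the contents of register `N`, store in cell `x` of array `b` the
value that `p` computes in register 18 from the contents `x` of register 16. -/
def fill (b N : ℕ) (p : Program) : Program :=
  .after [.const 16 0, .sub 17 N 16] <|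
    .whileNonzero 17 (.seq p (.after [.store b 16 18, .add 16 16 3] (.instr (.sub 17 N 16))))

/-- The body may disturb only registers from 17 on, and its result must not depend on array `b`,
which is being overwritten. -/
theorem ends_fill {b N : ℕ} {p : Program} {s : State} {T : ℕ} {g : ℕ → ℕ} (hN : N < 16)
    (h3 : s.reg 3 = 1)
    (hp : ∀ s' : State, s'.reg 16 < s.reg N → (∀ r < 16, s'.reg r = s.reg r) →
      (∀ b' ≠ b, s'.arr b' = s.arr b') →
      Ends p s' T fun s'' => (∀ r < 16, s''.reg r = s'.reg r) ∧ s''.reg 16 = s'.reg 16 ∧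
        s''.arr = s'.arr ∧ s''.reg 18 = g (s'.reg 16)) :
    Ends (fill b N p) s ((T + 4) * s.reg N + 3) fun s' => (∀ r < 16, s'.reg r = s.reg r) ∧
      (∀ b' ≠ b, s'.arr b' = s.arr b') ∧ ∀ x < s.reg N, s'.arr b x = g x := by
  let I : ℕ → State → Prop := fun μ s' => (∀ r < 16, s'.reg r = s.reg r) ∧
    (∀ b' ≠ b, s'.arr b' = s.arr b') ∧ (∀ x < s'.reg 16, s'.arr b x = g x) ∧
    s'.reg 17 = s.reg N - s'.reg 16 ∧ μ = s.reg N - s'.reg 16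
  have hne : ∀ r < 16, r ≠ 16 ∧ r ≠ 17 ∧ r ≠ 18 := by omega
  refine (Ends.after (Ends.whileNonzero (T := T + 3) I ?_ (μ := s.reg N) ?_)).mono ?_ ?_
  · rintro μ s₁ ⟨hr, ha, hx, h17, hμ⟩ h0
    refine (Ends.seq (hp s₁ (by omega) hr ha) fun s₂ h => Ends.after (Ends.instr (Q := fun s' =>
      ∃ μ' < μ, I μ' s') ?_)).mono (by simp) fun _ => id
    obtain ⟨hr₂, h16, ha₂, h18⟩ := h
    have h3' : s₂.reg 3 = 1 := by rw [hr₂ 3 (by omega), hr 3 (by omega), h3]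
    have hN' : s₂.reg N = s.reg N := by rw [hr₂ N hN, hr N hN]
    refine ⟨s.reg N - (s₁.reg 16 + 1), by omega, fun r h => ?_, fun b' hb' => ?_, ?_, ?_, ?_⟩
    · have := hne r h
      simp [Instr.exec, this, hr₂ r h, hr r h]
    · simp [Instr.exec, hb', ha₂, ha b' hb']
    · intro x hlt
      simp [Instr.exec, h3', h16] at hlt
      simp only [Instr.exec, List.foldl_cons, List.foldl_nil, Function.update_self,
        Function.update_apply, h16, h18]
      split_ifs with h
      · rw [h]
      · rw [ha₂]
        exact hx x (by omega)
    · have := hne N hN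
      simp [Instr.exec, this, h3', hN', h16]
    · simp [Instr.exec, h3', h16]
  · have hN' := hne N hN
    refine ⟨fun r h => ?_, fun b' hb' => ?_, ?_, ?_, ?_⟩
    · have := hne r h
      simp [Instr.exec, this]
    all_goals simp [Instr.exec, hN']
  · simp
  · rintro s' ⟨h0, μ, hr, ha, hx, h17, -⟩
    exact ⟨hr, ha, fun x hlt => hx x (by omega)⟩

end RAM

namespace RAM

open RootedDigraph

/-- Lets later steps forget the explicit state after straight-line code and keep only `R`. -/
theorem Ends.after_of {l : List Instr} {p : Program} {s : State} {T : ℕ} {Q : State → Prop}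
    (R : State → Prop) (hR : R (l.foldl (fun s c => c.exec s) s))
    (h : ∀ s', R s' → Ends p s' T Q) : Ends (Program.after l p) s (T + l.length) Q :=
  Ends.after (h _ hR)

/-! ### Testing root-connectivity by graph search -/

section Connectivity

variable {n m : ℕ} {D : RootedDigraph (Fin n) (Fin m)}

/-- The registers below 8 and the arrays 0 and 1 describe the digraph `D`. -/
structure Describes (D : RootedDigraph (Fin n) (Fin m)) (s : State) : Prop where
  reg0 : s.reg 0 = n
  reg1 : s.reg 1 = m
  reg3 : s.reg 3 = 1
  reg4 : s.reg 4 = 0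
  reg6 : s.reg 6 = n + 1
  tail : ∀ a : Fin m, s.arr 0 a.1 = vertexCode (D.tail a)
  head : ∀ a : Fin m, s.arr 1 a.1 = (D.head a).1 + 1

theorem Describes.congr {s s' : State} (h : Describes D s) (hr : ∀ r < 8, s'.reg r = s.reg r)
    (h0 : s'.arr 0 = s.arr 0) (h1 : s'.arr 1 = s.arr 1) : Describes D s' where
  reg0 := (hr 0 (by omega)).trans h.reg0
  reg1 := (hr 1 (by omega)).trans h.reg1
  reg3 := (hr 3 (by omega)).trans h.reg3
  reg4 := (hr 4 (by omega)).trans h.reg4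
  reg6 := (hr 6 (by omega)).trans h.reg6
  tail := h0 ▸ h.tail
  head := h1 ▸ h.head

/-- Array `b` holds the 0/1-array of the vertex set `W`, indexed by vertex codes. -/
def State.Marks (s : State) (b : ℕ) (W : Finset (Fin n)) : Prop :=
  ∀ v : Fin n, s.arr b (v.1 + 1) = if v ∈ W then 1 else 0

/-- Set register 24 to zero if and only if deleting the arcs marked in array `B` leaves a
root-connected digraph. -/
def connTest (B : ℕ) : Program :=
  .seq (fill 11 6 (.instr (.sub 18 3 16))) <|
  .after [.const 20 0, .const 21 0, .sub 22 1 20] <|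
  .seq
    (.whileNonzero 22 <|
      .after [.load 23 0 20, .load 23 11 23, .sub 23 3 23, .load 24 1 20, .load 25 11 24,
        .add 23 23 25, .load 25 B 20, .add 23 23 25] <|
      .seq
        (.ifNonzero 23 (.instr (.add 20 20 3))
          (.after [.store 11 24 3, .add 21 21 3] (.instr (.const 20 0))))
        (.instr (.sub 22 1 20)))
    (.instr (.sub 24 0 21))

/-- The time that `connTest` needs. -/
def connTime (n m : ℕ) : ℕ := 14 * (n * (m + 1) + m) + 5 * (n + 1) + 8

/-- A lexicographic measure: a new vertex is worth a full rescan of the arc list. -/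
theorem progress_lt {n m c c' e e' : ℕ} (hc : c < c') (hc' : c' ≤ n) (he : e ≤ m) :
    (n - c') * (m + 1) + (m - e') < (n - c) * (m + 1) + (m - e) := by
  have h : (n - c' + 1) * (m + 1) ≤ (n - c) * (m + 1) := Nat.mul_le_mul_right _ (by omega)
  rw [Nat.add_mul] at h
  omega

/-- The invariant of the loop of `connTest`: `W` is the set of marked vertices. -/
structure ConnInv (D : RootedDigraph (Fin n) (Fin m)) (S : Finset (Fin m)) (s₀ : State) (μ : ℕ)
    (s : State) (W : Finset (Fin n)) : Prop where
  reg : ∀ r < 16, s.reg r = s₀.reg r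
  arr : ∀ b ≠ 11, s.arr b = s₀.arr b
  root : s.arr 11 0 = 1
  marks : s.Marks 11 W
  count : s.reg 21 = W.card
  le : s.reg 20 ≤ m
  rest : s.reg 22 = m - s.reg 20
  reach : ∀ T : Finset (Fin n), (∃ v ∈ T, v ∈ W) → ∃ a ∉ S, D.Enters a T
  scanned : ∀ a : Fin m, a.1 < s.reg 20 → a ∉ S → D.head a ∉ W →
    ∃ u, D.tail a = some u ∧ u ∉ W
  measure : μ = (n - W.card) * (m + 1) + (m - s.reg 20)

theorem ends_connTest {B : ℕ} (hB : B ≠ 11) {s : State} (hs : Describes D s)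
    {S : Finset (Fin m)} (hS : s.Holds B S) :
    Ends (connTest B) s (connTime n m) fun s' => (∀ r < 16, s'.reg r = s.reg r) ∧
      (∀ b ≠ 11, s'.arr b = s.arr b) ∧
      (s'.reg 24 = 0 ↔ (D.deleteArcs S).RootConnected 1) := by
  have hfill := ends_fill (b := 11) (N := 6) (p := .instr (.sub 18 3 16)) (s := s) (T := 1)
    (g := fun x => 1 - x) (by omega) hs.reg3 (fun s' _ hr _ => Ends.instr (by
      have : ∀ r < 16, r ≠ 18 := by omega
      refine ⟨fun r h => ?_, ?_, ?_, ?_⟩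
      · simp [Instr.exec, this r h]
      all_goals simp [Instr.exec, hr 3 (by omega), hs.reg3]))
  rw [hs.reg6] at hfill
  have hne : ∀ r < 16, r ≠ 20 ∧ r ≠ 21 ∧ r ≠ 22 ∧ r ≠ 23 ∧ r ≠ 24 ∧ r ≠ 25 := by omega
  let I : ℕ → State → Prop := fun μ s' => ∃ W, ConnInv D S s μ s' W
  have hstep : ∀ μ s₁, I μ s₁ → s₁.reg 22 ≠ 0 → Ends
      (.after [.load 23 0 20, .load 23 11 23, .sub 23 3 23, .load 24 1 20, .load 25 11 24,
        .add 23 23 25, .load 25 B 20, .add 23 23 25] <|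
      .seq
        (.ifNonzero 23 (.instr (.add 20 20 3))
          (.after [.store 11 24 3, .add 21 21 3] (.instr (.const 20 0))))
        (.instr (.sub 22 1 20))) s₁ 13 fun s' => ∃ μ' < μ, I μ' s' := by
    rintro μ s₁ ⟨W, hI⟩ h22
    have hlt : s₁.reg 20 < m := by
      have := hI.rest
      omega
    let a : Fin m := ⟨s₁.reg 20, hlt⟩
    have hD : Describes D s₁ := hs.congr (fun r h => hI.reg r (by omega)) (hI.arr 0 (by omega))
      (hI.arr 1 (by omega))
    have htail : s₁.arr 0 (s₁.reg 20) = vertexCode (D.tail a) := hD.tail a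
    have hhead : s₁.arr 1 (s₁.reg 20) = (D.head a).1 + 1 := hD.head a
    have hBa : s₁.arr B (s₁.reg 20) = if a ∈ S then 1 else 0 := by
      rw [hI.arr B hB]
      exact hS a
    have hmh := hI.marks (D.head a)
    -- Register 23 adds up the reasons to skip `a`: tail unreached, head reached, arc deleted. It is
    -- zero exactly when `a` reaches a new vertex.
    refine (Ends.after_of (fun s₂ => (∀ r < 16, s₂.reg r = s₁.reg r) ∧ s₂.arr = s₁.arr ∧
      s₂.reg 20 = s₁.reg 20 ∧ s₂.reg 21 = s₁.reg 21 ∧ s₂.reg 24 = (D.head a).1 + 1 ∧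
      s₂.reg 23 = (1 - s₁.arr 11 (vertexCode (D.tail a))) + (if D.head a ∈ W then 1 else 0) +
        if a ∈ S then 1 else 0) ?_ ?_ (T := 5)).mono (by simp) fun _ => id
    · refine ⟨fun r h => ?_, ?_, ?_, ?_, ?_, ?_⟩
      · simp [Instr.exec, hne r h]
      all_goals simp [Instr.exec, htail, hhead, hmh, hBa, hD.reg3]
    rintro s₂ ⟨hr, ha, h20, h21, h24, h23⟩
    have h3 : s₂.reg 3 = 1 := by rw [hr 3 (by omega), hD.reg3]
    have h1 : s₂.reg 1 = m := by rw [hr 1 (by omega), hD.reg1]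
    refine Ends.seq (R := fun s₃ => ∃ W', (∀ r < 16, s₃.reg r = s.reg r) ∧
      (∀ b ≠ 11, s₃.arr b = s.arr b) ∧ s₃.arr 11 0 = 1 ∧ s₃.Marks 11 W' ∧
      s₃.reg 21 = W'.card ∧ s₃.reg 20 ≤ m ∧
      (∀ T : Finset (Fin n), (∃ v ∈ T, v ∈ W') → ∃ a ∉ S, D.Enters a T) ∧
      (∀ a : Fin m, a.1 < s₃.reg 20 → a ∉ S → D.head a ∉ W' →
        ∃ u, D.tail a = some u ∧ u ∉ W') ∧
      (n - W'.card) * (m + 1) + (m - s₃.reg 20) < μ) (T := 4) (T' := 1)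
      (Ends.ifNonzero (T := 3) (fun h => ?_) fun h => ?_) ?_
    · refine (Ends.instr ?_).mono (by omega) fun _ => id
      have e20 : (Instr.exec (.add 20 20 3) s₂).reg 20 = s₁.reg 20 + 1 := by
        simp [Instr.exec, h20, h3]
      refine ⟨W, fun r h => ?_, fun b hb => ?_, ?_, fun v => ?_, ?_, ?_, hI.reach, ?_, ?_⟩
      · simp [Instr.exec, hne r h, hr r h, hI.reg r h]
      · simp [Instr.exec, ha, hI.arr b hb]
      · simp [Instr.exec, ha, hI.root]
      · simp [Instr.exec, ha, hI.marks v]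
      · simp [Instr.exec, h21, hI.count]
      · omega
      · rw [e20]
        intro a' ha' haS haW
        rcases Nat.lt_succ_iff_lt_or_eq.1 ha' with h' | h'
        · exact hI.scanned a' h' haS haW
        · obtain rfl : a' = a := Fin.ext h'
          rw [h23, if_neg haS, if_neg haW] at h
          rcases hta : D.tail a with _ | u
          · simp [hta, vertexCode, hI.root] at h
          · refine ⟨u, rfl, fun hu => ?_⟩
            have := hI.marks u
            simp [hta, vertexCode, this, hu] at h
      · rw [e20, hI.measure]
        omega
    · have haS : a ∉ S := fun h' => by simp [h', h] at h23
      have haW : D.head a ∉ W := fun h' => by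
        rw [h, if_pos h', if_neg haS] at h23
        omega
      have htW : ∀ u, D.tail a = some u → u ∈ W := fun u hu => by
        by_contra hW
        have := hI.marks u
        simp [h, hu, vertexCode, this, hW, haS, haW] at h23
      have hcard : (insert (D.head a) W).card = W.card + 1 := Finset.card_insert_of_notMem haW
      -- The scan restarts at arc 0, since arcs skipped earlier may leave the vertex just reached.
      refine (Ends.after (Ends.instr ?_)).mono (by simp) fun _ => id
      refine ⟨insert (D.head a) W, fun r h => ?_, fun b hb => ?_, ?_, fun v => ?_, ?_, ?_, ?_,
        ?_, ?_⟩
      · simp [Instr.exec, hne r h, hr r h, hI.reg r h]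
      · simp [Instr.exec, hb, ha, hI.arr b hb]
      · simp [Instr.exec, h24, ha, hI.root]
      · have := hI.marks v
        by_cases hv : v = D.head a
        · simp [Instr.exec, hv, h24, h3]
        · have hv' : v.1 ≠ (D.head a).1 := fun h => hv (Fin.ext h)
          simp [Instr.exec, hv, hv', h24, ha, this]
      · simp [Instr.exec, h21, h3, hcard, hI.count]
      · simp [Instr.exec]
      · rintro T ⟨v, hvT, hv⟩
        by_cases hT : ∃ v ∈ T, v ∈ W
        · exact hI.reach T hT
        · push Not at hT
          rcases Finset.mem_insert.1 hv with rfl | hv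
          · exact ⟨a, haS, hvT, fun u hu hau => hT u hu (htW u hau)⟩
          · exact absurd hv (hT v hvT)
      · simp [Instr.exec]
      · rw [hI.measure]
        refine progress_lt (by omega) ?_ hI.le
        simpa using Finset.card_le_univ (insert (D.head a) W)
    · rintro s₃ ⟨W', hr, ha, h0, hm, h21, h20, hreach, hscan, hμ⟩
      refine Ends.instr ⟨_, hμ, W', ?_⟩
      have h1 : s₃.reg 1 = m := by rw [hr 1 (by omega), hs.reg1]
      constructor
      · intro r h
        simp [Instr.exec, hne r h, hr r h]
      all_goals first | assumption | simp [Instr.exec, h1]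
  refine (Ends.seq hfill fun s₁ h₁ => Ends.after (Ends.seq (Ends.whileNonzero I hstep
    (μ := n * (m + 1) + m) ?_) fun s₂ h₂ => Ends.instr (Q := fun s' =>
      (∀ r < 16, s'.reg r = s.reg r) ∧ (∀ b ≠ 11, s'.arr b = s.arr b) ∧
      (s'.reg 24 = 0 ↔ (D.deleteArcs S).RootConnected 1)) ?_)).mono ?_ fun _ => id
  · obtain ⟨hr, ha, hx⟩ := h₁
    have h1 : s₁.reg 1 = m := by rw [hr 1 (by omega), hs.reg1]
    refine ⟨∅, ?_⟩
    constructor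
    · intro r h
      simp [Instr.exec, hne r h, hr r h]
    · intro b hb
      simp [Instr.exec, ha b hb]
    · simp [Instr.exec, hx 0 (by omega)]
    · intro v
      simp [Instr.exec, hx (v.1 + 1) (by omega)]
    all_goals simp [Instr.exec, h1]
  · obtain ⟨h22, μ, W, hI⟩ := h₂
    have h20 : s₂.reg 20 = m := by
      have := hI.rest
      have := hI.le
      omega
    refine ⟨fun r h => ?_, fun b hb => ?_, ?_⟩
    · simp [Instr.exec, hne r h, hI.reg r h]
    · simp [Instr.exec, hI.arr b hb]
    · have hle : W.card ≤ n := by simpa using Finset.card_le_univ W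
      have h24 : (Instr.exec (.sub 24 0 21) s₂).reg 24 = n - W.card := by
        simp [Instr.exec, hI.reg 0 (by omega), hs.reg0, hI.count]
      -- After a full scan no surviving arc enters the complement of W, while every set meeting W is
      -- entered. Root-connectivity thus means that W is everything.
      rw [h24, rootConnected_deleteArcs_one]
      constructor
      · rintro h0 T ⟨v, hv⟩
        have hW : W = Finset.univ := (Finset.card_eq_iff_eq_univ W).1 (by simp; omega)
        exact hI.reach T ⟨v, hv, hW ▸ Finset.mem_univ v⟩
      · intro hc
        by_contra hne0
        obtain ⟨a, haS, ha1, ha2⟩ := hc Wᶜ (by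
          rw [Finset.nonempty_iff_ne_empty, Ne, Finset.compl_eq_empty_iff]
          rintro rfl
          simp at hne0)
        obtain ⟨u, hu, huW⟩ := hI.scanned a (by omega) haS (by simpa using ha1)
        exact ha2 u (by simpa using huW) hu
  · simp only [connTime, List.length_cons, List.length_nil]
    omega

end Connectivity

end RAM

namespace RAM

open RootedDigraph

/-! ### The greedy enlargement on the machine -/

section Growth

variable {n m : ℕ} {D : RootedDigraph (Fin n) (Fin m)}

theorem vertexCode_injective : Function.Injective (vertexCode (n := n)) := by
  rintro (_ | u) (_ | v) h
  · rfl
  · simp [vertexCode] at h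
  · simp [vertexCode] at h
  · simp only [vertexCode, Nat.add_right_cancel_iff] at h
    rw [Fin.ext h]

theorem vertexCode_le (u : Option (Fin n)) : vertexCode u ≤ n := by
  rcases u with _ | v
  · exact Nat.zero_le n
  · exact v.2

/-- The arrays `B`, `R`, 10 hold the arcs, the vertices and the quotas of the stage `g`. -/
structure Represents (B R : ℕ) (g : Growth (Fin n) (Fin m)) (s : State) : Prop where
  arcs : s.Holds B g.arcs
  verts : s.Marks R g.verts
  quota : ∀ u, s.arr 10 (vertexCode u) = g.quota u

/-- Add arcs to the stage represented by the arrays `B`, `R`, 10 until it is stable. The arcs in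
array `F` are forbidden, and new vertices get the contents of register `h` as their quota. -/
def grow (B F R h : ℕ) : Program :=
  .after [.const 8 0, .sub 9 1 8] <|
  .whileNonzero 9 <|
    .after [.load 10 0 8, .load 11 10 10, .sub 15 3 11, .load 12 1 8, .load 13 R 12,
      .add 15 15 13, .load 14 F 8, .add 15 15 14] <|
    .seq
      (.ifNonzero 15 (.instr (.add 8 8 3)) <|
        .after [.store B 8 3] <|
        .seq (connTest B) <|
        .ifNonzero 24
          (.after [.store B 8 4] (.instr (.add 8 8 3)))
          (.after [.store R 12 3, .sub 11 11 3, .store 10 10 11, .store 10 12 h]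
            (.instr (.const 8 0))))
      (.instr (.sub 9 1 8))

/-- The time that `grow` needs. -/
def growTime (n m : ℕ) : ℕ := (connTime n m + 17 + 1) * (n * (m + 1) + m) + 3

/-- The invariant of the loop of `grow` that does not depend on the position in the arc list. -/
structure GrowInv (D : RootedDigraph (Fin n) (Fin m)) (B R : ℕ) (F' : Finset (Fin m)) (h : ℕ)
    (g₀ : Growth (Fin n) (Fin m)) (s₀ s : State) (g : Growth (Fin n) (Fin m)) : Prop where
  reg : ∀ r < 8, s.reg r = s₀.reg r
  arr : ∀ b, b ≠ B → b ≠ R → b ≠ 10 → b ≠ 11 → s.arr b = s₀.arr b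
  rep : Represents B R g s
  grows : Growth.Grows D F' h g₀ g
  le : s.reg 8 ≤ m
  scanned : ∀ a : Fin m, a.1 < s.reg 8 → ¬ g.Addable D F' a

theorem ends_grow {B F R h : ℕ} (hB : B ≠ 0 ∧ B ≠ 1 ∧ B ≠ 10 ∧ B ≠ 11)
    (hF : F ≠ 10 ∧ F ≠ 11) (hR : R ≠ 0 ∧ R ≠ 1 ∧ R ≠ 10 ∧ R ≠ 11)
    (hBF : B ≠ F) (hBR : B ≠ R) (hFR : F ≠ R) (hh : h < 8) {s : State} (hs : Describes D s)
    {F' : Finset (Fin m)} (hF' : s.Holds F F') {g : Growth (Fin n) (Fin m)}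
    (hg : g.Valid D F') (hrep : Represents B R g s) :
    Ends (grow B F R h) s (growTime n m) fun s' => ∃ g', (∀ r < 8, s'.reg r = s.reg r) ∧
      (∀ b, b ≠ B → b ≠ R → b ≠ 10 → b ≠ 11 → s'.arr b = s.arr b) ∧
      Represents B R g' s' ∧ Growth.Grows D F' (s.reg h) g g' ∧ g'.Stable D F' := by
  have hne : ∀ r < 8, r ≠ 8 ∧ r ≠ 9 ∧ r ≠ 10 ∧ r ≠ 11 ∧ r ≠ 12 ∧ r ≠ 13 ∧ r ≠ 14 ∧ r ≠ 15 := by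
    omega
  obtain ⟨hB0, hB1, hB10, hB11⟩ := hB
  obtain ⟨hR0, hR1, hR10, hR11⟩ := hR
  let I : ℕ → State → Prop := fun μ s' => ∃ g', GrowInv D B R F' (s.reg h) g s s' g' ∧
    s'.reg 9 = m - s'.reg 8 ∧ μ = (n - g'.verts.card) * (m + 1) + (m - s'.reg 8)
  have hstep : ∀ μ s₁, I μ s₁ → s₁.reg 9 ≠ 0 → Ends
      (.after [.load 10 0 8, .load 11 10 10, .sub 15 3 11, .load 12 1 8, .load 13 R 12,
        .add 15 15 13, .load 14 F 8, .add 15 15 14] <|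
      .seq
        (.ifNonzero 15 (.instr (.add 8 8 3)) <|
          .after [.store B 8 3] <|
          .seq (connTest B) <|
          .ifNonzero 24
            (.after [.store B 8 4] (.instr (.add 8 8 3)))
            (.after [.store R 12 3, .sub 11 11 3, .store 10 10 11, .store 10 12 h]
              (.instr (.const 8 0))))
        (.instr (.sub 9 1 8))) s₁ (connTime n m + 17) fun s' => ∃ μ' < μ, I μ' s' := by
    rintro μ s₁ ⟨g₁, hI, h9, hμ⟩ hne9
    have hlt : s₁.reg 8 < m := by omega
    let a : Fin m := ⟨s₁.reg 8, hlt⟩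
    have hD : Describes D s₁ := hs.congr hI.reg
      (hI.arr 0 hB0.symm hR0.symm (by omega) (by omega))
      (hI.arr 1 hB1.symm hR1.symm (by omega) (by omega))
    have hV := hI.grows.valid hg
    have htail : s₁.arr 0 (s₁.reg 8) = vertexCode (D.tail a) := hD.tail a
    have hhead : s₁.arr 1 (s₁.reg 8) = (D.head a).1 + 1 := hD.head a
    have hFa : s₁.arr F (s₁.reg 8) = if a ∈ F' then 1 else 0 := by
      rw [hI.arr F hBF.symm hFR hF.1 hF.2]
      exact hF' a
    have hRa := hI.rep.verts (D.head a)
    have hqa := hI.rep.quota (D.tail a)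
    -- Register 15 is zero exactly when `a` passes all conditions but connectivity; truncated
    -- subtraction turns any positive quota into 0.
    refine (Ends.after_of (fun s₂ => (∀ r < 8, s₂.reg r = s₁.reg r) ∧ s₂.arr = s₁.arr ∧
      s₂.reg 8 = s₁.reg 8 ∧ s₂.reg 10 = vertexCode (D.tail a) ∧
      s₂.reg 11 = g₁.quota (D.tail a) ∧ s₂.reg 12 = (D.head a).1 + 1 ∧
      s₂.reg 15 = (1 - g₁.quota (D.tail a)) + (if D.head a ∈ g₁.verts then 1 else 0) +
        if a ∈ F' then 1 else 0) ?_ ?_ (T := connTime n m + 9)).mono (by simp) fun _ => id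
    · refine ⟨fun r h => ?_, ?_, ?_, ?_, ?_, ?_, ?_⟩
      · simp [Instr.exec, hne r h]
      all_goals simp [Instr.exec, htail, hhead, hFa, hRa, hqa, hD.reg3]
    rintro s₂ ⟨hr, ha, h8, h10, h11, h12, h15⟩
    have h3 : s₂.reg 3 = 1 := by rw [hr 3 (by omega), hD.reg3]
    have h4 : s₂.reg 4 = 0 := by rw [hr 4 (by omega), hD.reg4]
    have hhr : s₂.reg h = s.reg h := by rw [hr h hh, hI.reg h hh]
    -- what remains to be shown when `a` turns out not to be addable
    have hskip : ∀ s₃ : State, (∀ r < 8, s₃.reg r = s₁.reg r) →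
        (∀ b, b ≠ B → b ≠ R → b ≠ 10 → b ≠ 11 → s₃.arr b = s₁.arr b) →
        Represents B R g₁ s₃ → s₃.reg 8 = s₁.reg 8 + 1 → ¬ g₁.Addable D F' a →
        ∃ g', GrowInv D B R F' (s.reg h) g s s₃ g' ∧
          (n - g'.verts.card) * (m + 1) + (m - s₃.reg 8) < μ := by
      intro s₃ hr₃ ha₃ hrep₃ h8₃ hadd
      refine ⟨g₁, ⟨fun r h => (hr₃ r h).trans (hI.reg r h), fun b h1 h2 h3 h4 =>
        (ha₃ b h1 h2 h3 h4).trans (hI.arr b h1 h2 h3 h4), hrep₃, hI.grows, by omega,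
        fun a' ha' => ?_⟩, by omega⟩
      rw [h8₃] at ha'
      rcases Nat.lt_succ_iff_lt_or_eq.1 ha' with h' | h'
      · exact hI.scanned a' h'
      · obtain rfl : a' = a := Fin.ext h'
        exact hadd
    refine Ends.seq (R := fun s₃ => ∃ g', GrowInv D B R F' (s.reg h) g s s₃ g' ∧
        (n - g'.verts.card) * (m + 1) + (m - s₃.reg 8) < μ) (T := connTime n m + 8) (T' := 1)
      (Ends.ifNonzero (T := connTime n m + 7) (fun hne15 => ?_) fun h0 => ?_) ?_
    · refine (Ends.instr (hskip _ (fun r h => ?_) (fun b _ _ _ _ => ?_) ⟨fun a' => ?_,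
        fun v => ?_, fun u => ?_⟩ ?_ fun hadd => hne15 ?_)).mono (by omega) fun _ => id
      · simp [Instr.exec, hne r h, hr r h]
      · simp [Instr.exec, ha]
      · simp [Instr.exec, ha, hI.rep.arcs a']
      · simp [Instr.exec, ha, hI.rep.verts v]
      · simp [Instr.exec, ha, hI.rep.quota u]
      · simp [Instr.exec, h8, h3]
      · have := hadd.1
        rw [h15, if_neg hadd.2.1, if_neg hadd.2.2.1]
        omega
    · have haF : a ∉ F' := fun h' => by
        rw [h0, if_pos h'] at h15
        omega
      have haR : D.head a ∉ g₁.verts := fun h' => by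
        rw [h0, if_pos h', if_neg haF] at h15
        omega
      have hq : g₁.quota (D.tail a) ≠ 0 := by
        rw [h0, if_neg haR, if_neg haF] at h15
        omega
      -- The arc is entered tentatively for the test; as it was absent before, clearing its cell
      -- restores the stage exactly.
      have haB : a ∉ g₁.arcs := fun h' => haR (hV.head_mem a h')
      refine (Ends.after_of (fun s₃ => s₃.reg = s₂.reg ∧ (∀ b ≠ B, s₃.arr b = s₁.arr b) ∧
        s₃.Holds B (insert a g₁.arcs)) ?_ ?_ (T := connTime n m + 6)).mono (by simp)
        fun _ => id
      · refine ⟨rfl, fun b hb => ?_, fun a' => ?_⟩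
        · simp [Instr.exec, hb, ha]
        · have := hI.rep.arcs a'
          by_cases haa : a' = a
          · simp [Instr.exec, haa, a, h8, h3]
          · have haa' : a'.1 ≠ s₁.reg 8 := fun h' => haa (Fin.ext h')
            simp [Instr.exec, haa, haa', h8, ha, this]
      rintro s₃ ⟨hr₃, ha₃, hB₃⟩
      have hD₃ : Describes D s₃ := hD.congr (fun r h => by rw [hr₃, hr r h])
        (ha₃ 0 hB0.symm) (ha₃ 1 hB1.symm)
      refine Ends.seq (T' := 6) (ends_connTest hB11 hD₃ hB₃) ?_
      rintro s₄ ⟨hr₄, ha₄, hconn⟩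
      rw [hr₃] at hr₄
      have h8' : s₄.reg 8 = s₁.reg 8 := (hr₄ 8 (by omega)).trans h8
      have h3' : s₄.reg 3 = 1 := (hr₄ 3 (by omega)).trans h3
      have h4' : s₄.reg 4 = 0 := (hr₄ 4 (by omega)).trans h4
      have hB₄ : ∀ a' : Fin m, s₄.arr B a'.1 = if a' ∈ insert a g₁.arcs then 1 else 0 :=
        fun a' => by rw [ha₄ B hB11]; exact hB₃ a'
      refine Ends.ifNonzero (T := 5) (fun h24 => ?_) fun h24 => ?_
      · refine (Ends.after (Ends.instr (hskip _ (fun r h => ?_) (fun b h1 h2 h3 h4 => ?_)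
          ⟨fun a' => ?_, fun v => ?_, fun u => ?_⟩ ?_
          fun hadd => h24 (hconn.2 hadd.2.2.2)))).mono (by simp) fun _ => id
        · simp [Instr.exec, hne r h, hr₄ r (by omega), hr r h]
        · simp [Instr.exec, h1, ha₄ b h4, ha₃ b h1]
        · by_cases haa : a' = a
          · simp [Instr.exec, haa, a, h8', h4', haB]
          · have haa' : a'.1 ≠ s₁.reg 8 := fun h' => haa (Fin.ext h')
            simp [Instr.exec, haa, haa', h8', hB₄]
        · simp [Instr.exec, hBR.symm, ha₄ R hR11, ha₃ R hBR.symm, hI.rep.verts v]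
        · simp [Instr.exec, hB10.symm, ha₄ 10, ha₃ 10 hB10.symm, hI.rep.quota u]
        · simp [Instr.exec, h8', h3']
      · have hadd : g₁.Addable D F' a := ⟨hq, haR, haF, hconn.1 h24⟩
        have h10' := (hr₄ 10 (by omega)).trans h10
        have h11' := (hr₄ 11 (by omega)).trans h11
        have h12' := (hr₄ 12 (by omega)).trans h12
        have hh' := (hr₄ h (by omega)).trans hhr
        have hh11 : h ≠ 11 := by omega
        refine (Ends.after (Ends.instr ?_)).mono (by simp) fun _ => id
        refine ⟨g₁.add D (s.reg h) a, ⟨fun r h => ?_, fun b h1 h2 h3 h4 => ?_,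
          ⟨fun a' => ?_, fun v => ?_, fun u => ?_⟩, hI.grows.tail ⟨a, hadd, rfl⟩, ?_, ?_⟩, ?_⟩
        · simp [Instr.exec, hne r h, hr₄ r (by omega), hr r h, hI.reg r h]
        · simp [Instr.exec, h2, h3, ha₄ b h4, ha₃ b h1, hI.arr b h1 h2 h3 h4]
        · simp [Instr.exec, hBR, hB10, hB₄, Growth.add]
        · have := hI.rep.verts v
          by_cases hv : v = D.head a
          · simp [Instr.exec, hR10, hv, h12', h3', Growth.add]
          · have hv' : v.1 ≠ (D.head a).1 := fun h => hv (Fin.ext h)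
            simp [Instr.exec, hR10, hv, hv', h12', Growth.add, ha₄ R hR11, ha₃ R hBR.symm, this]
        · have hcode : (D.head a).1 + 1 = vertexCode (some (D.head a)) := rfl
          have := hI.rep.quota u
          simp only [Instr.exec, List.foldl_cons, List.foldl_nil, Function.update_apply,
            Growth.add, h10', h11', h12', h3', hh', hcode, vertexCode_injective.eq_iff,
            hh11, hR10.symm, ha₄ 10 (by omega), ha₃ 10 hB10.symm, this, if_false, if_true,
            Nat.reduceEqDiff]
        · simp [Instr.exec]
        · simp [Instr.exec]
        · rw [hμ]
          have hc : (g₁.add D (s.reg h) a).verts.card = g₁.verts.card + 1 :=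
            Finset.card_insert_of_notMem haR
          refine progress_lt (by omega) ?_ hI.le
          simpa using Finset.card_le_univ (g₁.add D (s.reg h) a).verts
    · rintro s₃ ⟨g', hI', hlt'⟩
      have h1 : s₃.reg 1 = m := by rw [hI'.reg 1 (by omega), hs.reg1]
      refine Ends.instr ⟨_, hlt', g', ⟨fun r h => ?_, hI'.arr, ⟨hI'.rep.arcs, hI'.rep.verts,
        hI'.rep.quota⟩, hI'.grows, hI'.le, hI'.scanned⟩, ?_, ?_⟩
      · simp [Instr.exec, hne r h, hI'.reg r h]
      all_goals simp [Instr.exec, h1]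
  refine (Ends.after (Ends.whileNonzero I hstep (μ := (n - g.verts.card) * (m + 1) + m)
    ?_)).mono ?_ ?_
  · refine ⟨g, ⟨fun r h => ?_, fun b _ _ _ _ => rfl, ⟨hrep.arcs, hrep.verts, hrep.quota⟩,
      Relation.ReflTransGen.refl, ?_, ?_⟩, ?_, ?_⟩
    · simp [Instr.exec, hne r h]
    all_goals simp [Instr.exec, hs.reg1]
  · have : (connTime n m + 17 + 1) * ((n - g.verts.card) * (m + 1) + m) ≤
        (connTime n m + 17 + 1) * (n * (m + 1) + m) := by
      gcongr
      omega
    simp only [growTime, List.length_cons, List.length_nil]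
    omega
  · rintro s' ⟨h0, μ, g', hI, h9, -⟩
    have hle := hI.le
    exact ⟨g', hI.reg, hI.arr, hI.rep, hI.grows, fun a => hI.scanned a (by omega)⟩

end Growth

end RAM

namespace RAM

open RootedDigraph

/-! ### The complete algorithm -/

section Algorithm

variable {n m : ℕ} {D : RootedDigraph (Fin n) (Fin m)}

/-- Copy the first `|A|` cells of array `b'` to array `b`. -/
def copyArcs (b b' : ℕ) : Program := fill b 1 (.instr (.load 18 b' 16))

/-- Copy the 0/1-array of a vertex set from array `b'` to array `b`, indexed by vertex codes. -/
def copyVerts (b b' : ℕ) : Program :=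
  fill b 6 (.ifNonzero 16 (.after [.sub 19 16 3] (.instr (.load 18 b' 19))) (.instr (.const 18 0)))

/-- Array `b` becomes the complement of array `b'`. -/
def complArcs (b b' : ℕ) : Program :=
  fill b 1 (.after [.load 19 b' 16] (.instr (.sub 18 3 19)))

/-- Give the quota in register `h` to the root, and that in register `q` to the vertices marked in
array `R`. -/
def setQuotas (R h q : ℕ) : Program :=
  fill 10 6 (.ifNonzero 16 (.after [.load 19 R 16]
    (.ifNonzero 19 (.instr (.add 18 q 4)) (.instr (.const 18 0)))) (.instr (.add 18 h 4)))

theorem ends_copyArcs {b b' : ℕ} (hb : b' ≠ b) {s : State} (hs : Describes D s)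
    {S : Finset (Fin m)} (hS : s.Holds b' S) :
    Ends (copyArcs b b') s (5 * m + 3) fun s' => (∀ r < 16, s'.reg r = s.reg r) ∧
      (∀ c ≠ b, s'.arr c = s.arr c) ∧ s'.Holds b S := by
  have h := ends_fill (b := b) (N := 1) (p := .instr (.load 18 b' 16)) (s := s) (T := 1)
    (g := s.arr b') (by omega) hs.reg3 (fun s' _ _ ha => Ends.instr (by
      have : ∀ r < 16, r ≠ 18 := by omega
      refine ⟨fun r h => ?_, ?_, ?_, ?_⟩
      · simp [Instr.exec, this r h]
      all_goals simp [Instr.exec, ha b' hb]))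
  rw [hs.reg1] at h
  exact h.mono le_rfl fun s' ⟨hr, ha, hx⟩ => ⟨hr, ha, fun a => (hx a a.2).trans (hS a)⟩

theorem ends_complArcs {b b' : ℕ} (hb : b' ≠ b) {s : State} (hs : Describes D s)
    {S : Finset (Fin m)} (hS : s.Holds b' S) :
    Ends (complArcs b b') s (6 * m + 3) fun s' => (∀ c ≠ b, s'.arr c = s.arr c) ∧
      s'.Holds b Sᶜ := by
  have h := ends_fill (b := b) (N := 1)
    (p := .after [.load 19 b' 16] (.instr (.sub 18 3 19))) (s := s) (T := 2)
    (g := fun x => 1 - s.arr b' x) (by omega) hs.reg3 (fun s' _ hr ha =>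
      (Ends.after (Ends.instr (by
        have : ∀ r < 16, r ≠ 18 ∧ r ≠ 19 := by omega
        refine ⟨fun r h => ?_, ?_, ?_, ?_⟩
        · simp [Instr.exec, this r h]
        all_goals simp [Instr.exec, ha b' hb, hr 3 (by omega), hs.reg3]))).mono (by simp)
        fun _ => id)
  rw [hs.reg1] at h
  refine h.mono le_rfl fun s' ⟨_, ha, hx⟩ => ⟨ha, fun a => (hx a a.2).trans ?_⟩
  rw [hS a]
  by_cases haS : a ∈ S <;> simp [haS]

theorem ends_copyVerts {b b' : ℕ} (hb : b' ≠ b) {s : State} (hs : Describes D s)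
    {W : Finset (Fin n)} (hW : s.Holds b' W) :
    Ends (copyVerts b b') s (7 * (n + 1) + 3) fun s' => (∀ r < 16, s'.reg r = s.reg r) ∧
      (∀ c ≠ b, s'.arr c = s.arr c) ∧ s'.Marks b W := by
  have hne : ∀ r < 16, r ≠ 18 ∧ r ≠ 19 := by omega
  have h := ends_fill (b := b) (N := 6) (p := .ifNonzero 16
      (.after [.sub 19 16 3] (.instr (.load 18 b' 19))) (.instr (.const 18 0))) (s := s) (T := 3)
    (g := fun x => if x = 0 then 0 else s.arr b' (x - 1)) (by omega) hs.reg3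
    (fun s' _ hr ha => Ends.ifNonzero (T := 2)
      (fun h0 => (Ends.after (Ends.instr (by
        refine ⟨fun r h => ?_, ?_, ?_, ?_⟩
        · simp [Instr.exec, hne r h]
        all_goals simp [Instr.exec, ha b' hb, hr 3 (by omega), hs.reg3, h0]))).mono (by simp)
        fun _ => id)
      (fun h0 => (Ends.instr (by
        refine ⟨fun r h => ?_, ?_, ?_, ?_⟩
        · simp [Instr.exec, hne r h]
        all_goals simp [Instr.exec, h0])).mono (by omega) fun _ => id))
  rw [hs.reg6] at h
  refine h.mono le_rfl fun s' ⟨hr, ha, hx⟩ => ⟨hr, ha, fun v => ?_⟩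
  rw [hx (v.1 + 1) (by omega)]
  simpa using hW v

theorem ends_setQuotas {R h q : ℕ} (hR : R ≠ 10) (hh : h < 8) (hq : q < 8) {s : State}
    (hs : Describes D s) {W : Finset (Fin n)} (hW : s.Marks R W) (B : Finset (Fin m)) :
    Ends (setQuotas R h q) s (8 * (n + 1) + 3) fun s' => (∀ r < 16, s'.reg r = s.reg r) ∧
      (∀ c ≠ 10, s'.arr c = s.arr c) ∧
      ∀ u, s'.arr 10 (vertexCode u) = (Growth.start B W (s.reg h) (s.reg q)).quota u := by
  have hne : ∀ r < 16, r ≠ 18 ∧ r ≠ 19 := by omega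
  have hq19 : q ≠ 19 := by omega
  have hf := ends_fill (b := 10) (N := 6) (p := .ifNonzero 16 (.after [.load 19 R 16]
      (.ifNonzero 19 (.instr (.add 18 q 4)) (.instr (.const 18 0)))) (.instr (.add 18 h 4)))
    (s := s) (T := 4)
    (g := fun x => if x = 0 then s.reg h else if s.arr R x = 0 then 0 else s.reg q)
    (by omega) hs.reg3
    (fun s' _ hr ha => Ends.ifNonzero (T := 3)
      (fun h0 => (Ends.after (Ends.ifNonzero (T := 1)
        (fun h1 => Ends.instr (by
          simp [Instr.exec, ha R hR] at h1
          refine ⟨fun r h => ?_, ?_, ?_, ?_⟩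
          · simp [Instr.exec, hne r h]
          all_goals simp [Instr.exec, h0, h1, hq19, hr q (by omega), hr 4 (by omega), hs.reg4]))
        (fun h1 => Ends.instr (by
          simp [Instr.exec, ha R hR] at h1
          refine ⟨fun r h => ?_, ?_, ?_, ?_⟩
          · simp [Instr.exec, hne r h]
          all_goals simp [Instr.exec, h0, h1])))).mono (by simp) fun _ => id)
      (fun h0 => (Ends.instr (by
        refine ⟨fun r h => ?_, ?_, ?_, ?_⟩
        · simp [Instr.exec, hne r h]
        all_goals simp [Instr.exec, h0, hr h (by omega), hr 4 (by omega), hs.reg4])).mono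
        (by omega) fun _ => id))
  rw [hs.reg6] at hf
  refine hf.mono le_rfl fun s' ⟨hr, ha, hx⟩ => ⟨hr, ha, fun u => ?_⟩
  rw [hx _ (Nat.lt_succ_of_le (vertexCode_le u))]
  rcases u with _ | v
  · simp [vertexCode, Growth.start]
  · have := hW v
    by_cases hv : v ∈ W <;> simp [vertexCode, Growth.start, this, hv]

/-- Enlarge the subdigraph in the arrays `B` and `R`, avoiding the arcs in array `F`. -/
def enlarge (B F R h q : ℕ) : Program := .seq (setQuotas R h q) (grow B F R h)

theorem ends_enlarge {B F R h q : ℕ} (hB : B ≠ 0 ∧ B ≠ 1 ∧ B ≠ 10 ∧ B ≠ 11)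
    (hF : F ≠ 10 ∧ F ≠ 11) (hR : R ≠ 0 ∧ R ≠ 1 ∧ R ≠ 10 ∧ R ≠ 11)
    (hBF : B ≠ F) (hBR : B ≠ R) (hFR : F ≠ R) (hh : h < 8) (hq : q < 8) {s : State}
    (hs : Describes D s) {F' B' : Finset (Fin m)} {W : Finset (Fin n)} (hF' : s.Holds F F')
    (hB' : s.Holds B B') (hW : s.Marks R W)
    (hg : (Growth.start B' W (s.reg h) (s.reg q)).Valid D F') :
    Ends (enlarge B F R h q) s (8 * (n + 1) + 3 + growTime n m) fun s' =>
      ∃ g' : Growth (Fin n) (Fin m), (∀ r < 8, s'.reg r = s.reg r) ∧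
        (∀ b, b ≠ B → b ≠ R → b ≠ 10 → b ≠ 11 → s'.arr b = s.arr b) ∧
        s'.Holds B g'.arcs ∧ s'.Marks R g'.verts ∧
        Growth.Grows D F' (s.reg h) (Growth.start B' W (s.reg h) (s.reg q)) g' ∧
        g'.Stable D F' := by
  refine Ends.seq (ends_setQuotas hR.2.2.1 hh hq hs hW B') fun s₁ ⟨hr₁, ha₁, hq₁⟩ => ?_
  have hs₁ : Describes D s₁ := hs.congr (fun r h => hr₁ r (by omega)) (ha₁ 0 (by omega))
    (ha₁ 1 (by omega))
  have hF₁ : s₁.Holds F F' := fun a => by rw [ha₁ F hF.1]; exact hF' a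
  have hB₁ : s₁.Holds B B' := fun a => by rw [ha₁ B hB.2.2.1]; exact hB' a
  have hW₁ : s₁.Marks R W := fun v => by rw [ha₁ R hR.2.2.1]; exact hW v
  refine (ends_grow hB hF hR hBF hBR hFR hh hs₁ hF₁ hg ⟨hB₁, hW₁, hq₁⟩).mono le_rfl ?_
  rintro s₂ ⟨g', hr₂, ha₂, hrep, hgr, hst⟩
  rw [hr₁ h (by omega)] at hgr
  exact ⟨g', fun r h => (hr₂ r h).trans (hr₁ r (by omega)), fun b h1 h2 h3 h4 =>
    (ha₂ b h1 h2 h3 h4).trans (ha₁ b h3), hrep.arcs, hrep.verts, hgr, hst⟩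

/-- The algorithm: arrays 6, 7 and 8, 9 hold the arcs and the vertices of the two subdigraphs that
are enlarged. -/
def algorithm : Program :=
  -- Register 4 stays 0. It is the quota of new vertices in the first two enlargements, where core
  -- vertices get k from register 2; the third uses n + 1 from register 6 throughout.
  .after [.const 3 1, .add 6 0 3] <|
  .seq (copyArcs 6 3) <| .seq (copyArcs 7 5) <| .seq (copyVerts 8 2) <| .seq (copyVerts 9 4) <|
  .seq (enlarge 6 7 8 4 2) <| .seq (enlarge 7 6 9 4 2) <| .seq (enlarge 6 7 8 6 6) <|
  complArcs 7 6

/-- The time that `algorithm` needs. -/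
def algorithmTime (n m : ℕ) : ℕ :=
  (5 * m + 3) + ((5 * m + 3) + ((7 * (n + 1) + 3) + ((7 * (n + 1) + 3) +
    ((8 * (n + 1) + 3 + growTime n m) + ((8 * (n + 1) + 3 + growTime n m) +
      ((8 * (n + 1) + 3 + growTime n m) + (6 * m + 3))))))) + 2

open Polynomial in
-- The time bound is monotone, so both arguments may be replaced by n + m.
theorem exists_algorithmTime_le :
    ∃ p : Polynomial ℕ, ∀ n m, algorithmTime n m ≤ p.eval (n + m) := by
  let c : ℕ[X] := 14 * (X * (X + 1) + X) + 5 * (X + 1) + 8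
  let g : ℕ[X] := (c + 17 + 1) * (X * (X + 1) + X) + 3
  refine ⟨(5 * X + 3) + ((5 * X + 3) + ((7 * (X + 1) + 3) + ((7 * (X + 1) + 3) +
    ((8 * (X + 1) + 3 + g) + ((8 * (X + 1) + 3 + g) +
      ((8 * (X + 1) + 3 + g) + (6 * X + 3))))))) + 2, fun n m => ?_⟩
  simp only [algorithmTime, growTime, connTime, c, g, eval_add, eval_mul, eval_X, eval_one,
    eval_ofNat]
  have hn : n ≤ n + m := Nat.le_add_right _ _
  have hm : m ≤ n + m := Nat.le_add_left _ _
  gcongr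

theorem arrayOf_ofFn (f : Fin n → ℕ) (i : Fin n) : arrayOf (List.ofFn f) i.1 = f i := by
  simp [arrayOf]

theorem ends_algorithm {k : ℕ} {X₁ X₂ : D.Subdigraph} (hk : 1 ≤ k)
    (hdisj : X₁.ArcDisjoint X₂) (hext : X₁.Extendable X₂)
    (hX₁ : X₁.IsCompactCore k) (hX₂ : X₂.IsCompactCore k) :
    Ends algorithm (inputState D k X₁ X₂) (algorithmTime n m) fun s =>
      ∃ g₁ g₂ g₃ : Growth (Fin n) (Fin m),
        Growth.Grows D X₂.arcs 0 (Growth.start X₁.arcs X₁.verts 0 k) g₁ ∧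
        g₁.Stable D X₂.arcs ∧
        Growth.Grows D g₁.arcs 0 (Growth.start X₂.arcs X₂.verts 0 k) g₂ ∧
        g₂.Stable D g₁.arcs ∧
        Growth.Grows D g₂.arcs (n + 1) (Growth.start g₁.arcs g₁.verts (n + 1) (n + 1)) g₃ ∧
        g₃.Stable D g₂.arcs ∧ s.Holds 6 g₃.arcs ∧ s.Holds 7 g₃.arcsᶜ := by
  refine Ends.after_of (fun s => Describes D s ∧ s.reg 2 = k ∧ s.Holds 2 X₁.verts ∧
    s.Holds 3 X₁.arcs ∧ s.Holds 4 X₂.verts ∧ s.Holds 5 X₂.arcs) ?_ ?_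
  · refine ⟨⟨?_, ?_, ?_, ?_, ?_, fun a => ?_, fun a => ?_⟩, ?_, fun v => ?_, fun a => ?_,
      fun v => ?_, fun a => ?_⟩
    · simp [Instr.exec, inputState, arrayOf]
    · simp [Instr.exec, inputState, arrayOf]
    · simp [Instr.exec]
    · simp [Instr.exec, inputState, arrayOf]
    · simp [Instr.exec, inputState, arrayOf]
    · exact arrayOf_ofFn _ a
    · exact arrayOf_ofFn _ a
    · simp [Instr.exec, inputState, arrayOf]
    · exact arrayOf_ofFn _ v
    · exact arrayOf_ofFn _ a
    · exact arrayOf_ofFn _ v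
    · exact arrayOf_ofFn _ a
  rintro s₀ ⟨hD₀, hk₀, h2₀, h3₀, h4₀, h5₀⟩
  refine Ends.seq (ends_copyArcs (by omega) hD₀ h3₀) fun s₁ ⟨hr₁, ha₁, h6₁⟩ => ?_
  have hD₁ := hD₀.congr (fun r h => hr₁ r (by omega)) (ha₁ 0 (by omega)) (ha₁ 1 (by omega))
  refine Ends.seq (ends_copyArcs (by omega) hD₁ (b' := 5) (S := X₂.arcs) fun a => by
    rw [ha₁ 5 (by omega)]; exact h5₀ a) fun s₂ ⟨hr₂, ha₂, h7₂⟩ => ?_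
  have hD₂ := hD₁.congr (fun r h => hr₂ r (by omega)) (ha₂ 0 (by omega)) (ha₂ 1 (by omega))
  refine Ends.seq (ends_copyVerts (by omega) hD₂ (b' := 2) (W := X₁.verts) fun v => by
    rw [ha₂ 2 (by omega), ha₁ 2 (by omega)]; exact h2₀ v) fun s₃ ⟨hr₃, ha₃, h8₃⟩ => ?_
  have hD₃ := hD₂.congr (fun r h => hr₃ r (by omega)) (ha₃ 0 (by omega)) (ha₃ 1 (by omega))
  refine Ends.seq (ends_copyVerts (by omega) hD₃ (b' := 4) (W := X₂.verts) fun v => by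
    rw [ha₃ 4 (by omega), ha₂ 4 (by omega), ha₁ 4 (by omega)]; exact h4₀ v)
    fun s₄ ⟨hr₄, ha₄, h9₄⟩ => ?_
  have hD₄ := hD₃.congr (fun r h => hr₄ r (by omega)) (ha₄ 0 (by omega)) (ha₄ 1 (by omega))
  have hk₄ : s₄.reg 2 = k := by
    rw [hr₄ 2 (by omega), hr₃ 2 (by omega), hr₂ 2 (by omega), hr₁ 2 (by omega), hk₀]
  have h6₄ : s₄.Holds 6 X₁.arcs := fun a => by
    rw [ha₄ 6 (by omega), ha₃ 6 (by omega), ha₂ 6 (by omega)]; exact h6₁ a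
  have h7₄ : s₄.Holds 7 X₂.arcs := fun a => by
    rw [ha₄ 7 (by omega), ha₃ 7 (by omega)]; exact h7₂ a
  have h8₄ : s₄.Marks 8 X₁.verts := fun v => by rw [ha₄ 8 (by omega)]; exact h8₃ v
  have hv₁ := Growth.valid_start_core hk hX₁ hdisj hext.1
  refine Ends.seq (ends_enlarge (by omega) (by omega) (by omega) (by omega) (by omega) (by omega)
    (h := 4) (q := 2) (by omega) (by omega) hD₄ h7₄ h6₄ h8₄ (by rw [hD₄.reg4, hk₄]; exact hv₁))
    fun s₅ ⟨g₁, hr₅, ha₅, h6₅, h8₅, hg₁, hst₁⟩ => ?_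
  rw [hD₄.reg4, hk₄] at hg₁
  have hv₁' := hg₁.valid hv₁
  have hD₅ := hD₄.congr hr₅ (ha₅ 0 (by omega) (by omega) (by omega) (by omega))
    (ha₅ 1 (by omega) (by omega) (by omega) (by omega))
  have hk₅ : s₅.reg 2 = k := by rw [hr₅ 2 (by omega), hk₄]
  have h7₅ : s₅.Holds 7 X₂.arcs := fun a => by
    rw [ha₅ 7 (by omega) (by omega) (by omega) (by omega)]; exact h7₄ a
  have h9₅ : s₅.Marks 9 X₂.verts := fun v => by
    rw [ha₅ 9 (by omega) (by omega) (by omega) (by omega)]; exact h9₄ v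
  have hv₂ := Growth.valid_start_core hk hX₂ hv₁'.disjoint.symm hext.2
  refine Ends.seq (ends_enlarge (by omega) (by omega) (by omega) (by omega) (by omega) (by omega)
    (h := 4) (q := 2) (by omega) (by omega) hD₅ h6₅ h7₅ h9₅ (by rw [hD₅.reg4, hk₅]; exact hv₂))
    fun s₆ ⟨g₂, hr₆, ha₆, h7₆, h9₆, hg₂, hst₂⟩ => ?_
  rw [hD₅.reg4, hk₅] at hg₂
  have hv₂' := hg₂.valid hv₂
  have hD₆ := hD₅.congr hr₆ (ha₆ 0 (by omega) (by omega) (by omega) (by omega))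
    (ha₆ 1 (by omega) (by omega) (by omega) (by omega))
  have h6₆ : s₆.Holds 6 g₁.arcs := fun a => by
    rw [ha₆ 6 (by omega) (by omega) (by omega) (by omega)]; exact h6₅ a
  have h8₆ : s₆.Marks 8 g₁.verts := fun v => by
    rw [ha₆ 8 (by omega) (by omega) (by omega) (by omega)]; exact h8₅ v
  -- The third enlargement resumes from the first one's result with fresh quotas, now avoiding the
  -- enlarged second core.
  refine Ends.seq (ends_enlarge (by omega) (by omega) (by omega) (by omega) (by omega) (by omega)
    (h := 6) (q := 6) (by omega) (by omega) hD₆ h7₆ h6₆ h8₆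
    (hv₁'.restart hv₂'.disjoint.symm _ _))
    fun s₇ ⟨g₃, hr₇, ha₇, h6₇, _, hg₃, hst₃⟩ => ?_
  rw [hD₆.reg6] at hg₃
  have hD₇ := hD₆.congr hr₇ (ha₇ 0 (by omega) (by omega) (by omega) (by omega))
    (ha₇ 1 (by omega) (by omega) (by omega) (by omega))
  refine (ends_complArcs (by omega) hD₇ h6₇).mono le_rfl fun s₈ ⟨ha₈, h7₈⟩ =>
    ⟨g₁, g₂, g₃, hg₁, hst₁, hg₂, hst₂, hg₃, hst₃, fun a => ?_, h7₈⟩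
  rw [ha₈ 6 (by omega)]
  exact h6₇ a

end Algorithm

end RAM

theorem lemma4p1 :
    (∀ (V A : Type*) [Fintype V] [Fintype A] [DecidableEq V] [DecidableEq A]
        (D : RootedDigraph V A) (k : ℕ),
        1 ≤ k → D.RootConnected 2 → 2 * k - 1 ≤ Fintype.card V →
        ((∃ Z₁ Z₂ : D.Subdigraph, Z₁.ArcDisjoint Z₂ ∧
            Z₁.IsSpanningFlowBranching k ∧ Z₂.IsSpanningFlowBranching k) ↔
          ∃ X₁ X₂ : D.Subdigraph, X₁.ArcDisjoint X₂ ∧ X₁.Extendable X₂ ∧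
            X₁.IsCompactCore k ∧ X₂.IsCompactCore k)) ∧
    ∃ (P : RAM.Program) (p : Polynomial ℕ),
      ∀ (n m : ℕ) (D : RootedDigraph (Fin n) (Fin m)) (k : ℕ) (X₁ X₂ : D.Subdigraph),
        1 ≤ k → D.RootConnected 2 → 2 * k - 1 ≤ n →
        X₁.ArcDisjoint X₂ → X₁.Extendable X₂ →
        X₁.IsCompactCore k → X₂.IsCompactCore k →
        X₁.toDigraph.TripleFree → X₂.toDigraph.TripleFree →
        ∃ (t : ℕ) (s : RAM.State) (Z₁ Z₂ : D.Subdigraph),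
          RAM.Runs P (RAM.inputState D k X₁ X₂) t s ∧ t ≤ p.eval (n + m) ∧
          s.Holds 6 Z₁.arcs ∧ s.Holds 7 Z₂.arcs ∧
          Z₁.ArcDisjoint Z₂ ∧
          Z₁.IsSpanningFlowBranching k ∧ Z₂.IsSpanningFlowBranching k := by
  refine ⟨fun V A _ _ _ _ D k hk hD hV =>
    RootedDigraph.exists_spanningFlowBranchings_iff hk hD hV, ?_⟩
  obtain ⟨p, hp⟩ := RAM.exists_algorithmTime_le
  refine ⟨RAM.algorithm, p, fun n m D k X₁ X₂ hk hD hV hdisj hext hX₁ hX₂ _ _ => ?_⟩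
  obtain ⟨t, s, hr, ht, g₁, g₂, g₃, hg₁, hst₁, hg₂, hst₂, hg₃, hst₃, h6, h7⟩ :=
    RAM.ends_algorithm hk hdisj hext hX₁ hX₂
  have hV' : 2 * k - 1 ≤ Fintype.card (Fin n) := by rwa [Fintype.card_fin]
  obtain ⟨h₁, h₂⟩ := RootedDigraph.Growth.isSpanningFlowBranching_of_grows hk hD hV' hdisj hext
    hX₁ hX₂ hg₁ hst₁ hg₂ hst₂ (by rwa [Fintype.card_fin]) hst₃
  exact ⟨t, s, RootedDigraph.Subdigraph.spanning D g₃.arcs,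
    RootedDigraph.Subdigraph.spanning D g₃.arcsᶜ, hr, ht.trans (hp n m), h6, h7,
    disjoint_compl_right (a := g₃.arcs), h₁, h₂⟩
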